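/- Let $n \geq 3$ be an integer. If $K_1,\ldots,K_n \subset \mathbb{R}^2$ are pairwise disjoint convex sets such that the complement $S=\mathbb{R}^2 \setminus \bigcup_{i=1}^n K_i$ is a finite set of points, then $|S| \leq 5n-11$. Furthermore, for every $n \geq 3$ this bound is attained: there exist pairwise disjoint convex sets $K_1,\ldots,K_n \subset \mathbb{R}^2$ such that $S=\mathbb{R}^2 \setminus \bigcup_{i=1}^n K_i$ is finite and $|S| = 5n-11$. -/

import Mathlib

open Set Filter Topology

/-! Upper bound. After a shear the vertical direction is generic, and a vertical line sweeps the
plane from left to right. Let `L` and `R` count the sets unbounded to the left and to the right. An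
uncovered point adherent to a set strictly to its right (a birth) or strictly to its left (a death)
marks the extreme abscissa of that set, so there are at most `n - L` births and `n - R` deaths. Near
any other uncovered point only two sets occur, `a` just below and `b` just above, and a pair `(a,
b)` serves only one such point (`eq_of_pair`). This edge point is charged to the event that made `a`
and `b` adjacent: the death of the last set between them (at most `n - R`), or, if no set was
between them, the later of their two births. If that is the birth of `a`, ties included, then `a` is
not the top set (at most `n - 1`); if it is the birth of `b`, then `b` is not unbounded to the left
(at most `n - L`).

The total is `5n - 1 - 2(L + R)`. If the top and bottom sets coincide, nothing is uncovered;
otherwise both are unbounded on both sides, so `L, R ≥ 2`, and `L + R ≥ 5` gives the bound. If `L =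
R = 2`, the closures of the top and bottom sets meet on every vertical line, which leaves room for
one edge point only (`ncard_edgePoints_le_one`).

Lower bound. Three sectors with ownership switching once along each common ray leave 4 points.
Truncating a vertex where three sets meet by a small triangle adds one set, removes the vertex and
creates six points: the corners and side midpoints of the triangle (`exists_truncate`). A corner of
the triangle is again such a vertex, so this can be iterated. -/

/-! ### Convex sets on vertical lines. -/

/-- A strict vertical order between two disjoint convex plane sets is the same on every vertical
line that meets both. -/
theorem lt_of_lt_of_disjoint_convex {K L : Set (ℝ × ℝ)} (hK : Convex ℝ K) (hL : Convex ℝ L)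
    (hd : Disjoint K L) {t t' y z y' z' : ℝ} (h1 : (t, y) ∈ K) (h2 : (t, z) ∈ L)
    (h3 : (t', y') ∈ K) (h4 : (t', z') ∈ L) (h : y < z) : y' < z' := by
  by_contra hc
  push Not at hc
  have hpos : 0 < (z - y) + (y' - z') := by linarith
  -- These weights make the signed height differences `y - z` and `y' - z'` cancel, so the chords of
  -- `K` and `L` cross.
  have ha : 0 ≤ (y' - z') / ((z - y) + (y' - z')) := div_nonneg (by linarith) hpos.le
  have hb : 0 ≤ (z - y) / ((z - y) + (y' - z')) := div_nonneg (by linarith) hpos.le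
  have hab : (y' - z') / ((z - y) + (y' - z')) + (z - y) / ((z - y) + (y' - z')) = 1 := by
    field_simp; ring
  have e1 := hK h1 h3 ha hb hab
  have e2 := hL h2 h4 ha hb hab
  refine Set.disjoint_left.1 hd e1 ?_
  convert e2 using 1
  ext
  · simp
  · simp
    field_simp
    ring

/-- The vertical line at abscissa `t` meets `X`. -/
def MeetsVertical (X : Set (ℝ × ℝ)) (t : ℝ) : Prop := ∃ y, (t, y) ∈ X

theorem MeetsVertical.of_between {X : Set (ℝ × ℝ)} (hX : Convex ℝ X) {r t u : ℝ}
    (hr : MeetsVertical X r) (hu : MeetsVertical X u) (h1 : r ≤ t) (h2 : t ≤ u) :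
    MeetsVertical X t := by
  obtain ⟨y, hy⟩ := hr
  obtain ⟨z, hz⟩ := hu
  rcases eq_or_lt_of_le (h1.trans h2) with h | h
  · obtain rfl : r = t := le_antisymm h1 (h ▸ h2)
    exact ⟨y, hy⟩
  have hpos : 0 < u - r := by linarith
  have := hX hy hz (a := (u - t) / (u - r)) (b := (t - r) / (u - r))
    (div_nonneg (by linarith) hpos.le) (div_nonneg (by linarith) hpos.le) (by field_simp; ring)
  refine ⟨(u - t) / (u - r) * y + (t - r) / (u - r) * z, ?_⟩
  convert this using 1
  ext
  · simp; field_simp; ring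
  · simp

theorem mem_of_vertical_between {X : Set (ℝ × ℝ)} (hX : Convex ℝ X) {t y z w : ℝ}
    (hy : (t, y) ∈ X) (hw : (t, w) ∈ X) (h1 : y ≤ z) (h2 : z ≤ w) : (t, z) ∈ X := by
  rcases eq_or_lt_of_le (h1.trans h2) with h | h
  · obtain rfl : y = z := le_antisymm h1 (h ▸ h2)
    exact hy
  have hpos : 0 < w - y := by linarith
  have := hX hy hw (a := (w - z) / (w - y)) (b := (z - y) / (w - y))
    (div_nonneg (by linarith) hpos.le) (div_nonneg (by linarith) hpos.le) (by field_simp; ring)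
  convert this using 1
  ext
  · simp; field_simp; ring
  · simp; field_simp; ring

/-- A point strictly inside a vertical chord of a convex set that has points on both sides of
that chord is an interior point. -/
theorem mem_interior_of_vertical_chord {X : Set (ℝ × ℝ)} (hX : Convex ℝ X) {t y₁ y y₂ : ℝ}
    (h₁ : (t, y₁) ∈ X) (h₂ : (t, y₂) ∈ X) (hy₁ : y₁ < y) (hy₂ : y < y₂)
    (hl : ∃ p ∈ X, p.1 < t) (hr : ∃ p ∈ X, t < p.1) : (t, y) ∈ interior X := by
  obtain ⟨⟨l1, l2⟩, hl, hlt⟩ := hl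
  obtain ⟨⟨r1, r2⟩, hr, hrt⟩ := hr
  simp only at hlt hrt
  rw [mem_interior_iff_mem_nhds]
  have key : ∀ q1 q2 : ℝ, (q1, q2) ∈ X → q1 ≠ t → ∀ᶠ p : ℝ × ℝ in 𝓝 (t, y),
      0 ≤ (p.1 - t) / (q1 - t) → p ∈ X := by
    intro q1 q2 hq hne
    have hne' : q1 - t ≠ 0 := sub_ne_zero.2 hne
    have hc0 : ContinuousAt (fun p : ℝ × ℝ => (p.1 - t) / (q1 - t)) (t, y) := by fun_prop
    have hc : ContinuousAt (fun p : ℝ × ℝ =>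
        (p.2 - (p.1 - t) / (q1 - t) * q2) / (1 - (p.1 - t) / (q1 - t))) (t, y) := by
      refine ContinuousAt.div (by fun_prop) (by fun_prop) (by simp)
    have e0 : ∀ᶠ p : ℝ × ℝ in 𝓝 (t, y), (p.1 - t) / (q1 - t) < 1 :=
      hc0.eventually_lt continuousAt_const (by simp)
    have e1 := (continuousAt_const (y := y₁)).eventually_lt hc (by simpa using hy₁)
    have e2 := hc.eventually_lt (continuousAt_const (y := y₂)) (by simpa using hy₂)
    filter_upwards [e0, e1, e2] with p h0 h1 h2 h
    set a := (p.1 - t) / (q1 - t) with ha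
    have hz := mem_of_vertical_between hX h₁ h₂ h1.le h2.le
    have hpa : a * (q1 - t) = p.1 - t := by rw [ha]; field_simp
    have h1a : (1 - a) ≠ 0 := by linarith
    have := hX hq hz h (b := 1 - a) (by linarith) (by ring)
    convert this using 1
    ext
    · simp; linarith
    · simp; field_simp; ring
  filter_upwards [key l1 l2 hl hlt.ne, key r1 r2 hr hrt.ne'] with p hp1 hp2
  rcases le_total p.1 t with h | h
  · exact hp1 (div_nonneg_of_nonpos (by linarith) (by linarith))
  · exact hp2 (div_nonneg (by linarith) (by linarith))

/-! ### Sweep partitions: vertical order and neighbours of uncovered points. -/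

/-- A partition of the plane, up to finitely many points, into disjoint convex sets for which the
vertical direction is generic. -/
structure SweepPartition {ι : Type*} (K : ι → Set (ℝ × ℝ)) : Prop where
  convex : ∀ i, Convex ℝ (K i)
  disjoint : ∀ i j, i ≠ j → Disjoint (K i) (K j)
  finite : (⋃ i, K i)ᶜ.Finite
  injOn_fst : InjOn Prod.fst (⋃ i, K i)ᶜ
  -- No set that meets the vertical line of an uncovered point is born or dies on that line.
  crosses : ∀ s ∈ (⋃ i, K i)ᶜ, ∀ i, MeetsVertical (K i) s.1 →
    (∃ p ∈ K i, p.1 < s.1) ∧ ∃ p ∈ K i, s.1 < p.1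
  eq_of_up : ∀ i j t t' y y', (∀ z, y ≤ z → (t, z) ∈ K i) → (∀ z, y' ≤ z → (t', z) ∈ K j) → i = j
  eq_of_down : ∀ i j t t' y y', (∀ z, z ≤ y → (t, z) ∈ K i) → (∀ z, z ≤ y' → (t', z) ∈ K j) →
    i = j

/-- On some vertical line a point of `K i` lies below a point of `K j`. -/
def IsBelow {ι : Type*} (K : ι → Set (ℝ × ℝ)) (i j : ι) : Prop :=
  i ≠ j ∧ ∃ t y z, (t, y) ∈ K i ∧ (t, z) ∈ K j ∧ y < z

/-- `K a` covers a vertical interval ending at `s` from below, `K b` one from above. -/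
def IsNeighbourPair {ι : Type*} (K : ι → Set (ℝ × ℝ)) (s : ℝ × ℝ) (a b : ι) : Prop :=
  (∃ ε > 0, ∀ y, s.2 - ε < y → y < s.2 → (s.1, y) ∈ K a) ∧
    ∃ ε > 0, ∀ y, s.2 < y → y < s.2 + ε → (s.1, y) ∈ K b

/-- On a vertical line left of `x` the set `K c` lies between `K a` and `K b`. -/
def IsMid {ι : Type*} (K : ι → Set (ℝ × ℝ)) (a b : ι) (x : ℝ) (c : ι) : Prop :=
  IsBelow K a c ∧ IsBelow K c b ∧
    ∃ t < x, MeetsVertical (K a) t ∧ MeetsVertical (K b) t ∧ MeetsVertical (K c) t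

namespace SweepPartition

variable {ι : Type*} {K : ι → Set (ℝ × ℝ)}

theorem lt_of_isBelow (h : SweepPartition K) {i j : ι} (hb : IsBelow K i j) {t y z : ℝ}
    (hy : (t, y) ∈ K i) (hz : (t, z) ∈ K j) : y < z := by
  obtain ⟨hne, t', y', z', h1, h2, h3⟩ := hb
  exact lt_of_lt_of_disjoint_convex (h.convex i) (h.convex j) (h.disjoint i j hne) h1 h2 hy hz h3

theorem eq_of_mem (h : SweepPartition K) {i j : ι} {p : ℝ × ℝ} (hi : p ∈ K i) (hj : p ∈ K j) :
    i = j := by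
  by_contra hne
  exact Set.disjoint_left.1 (h.disjoint i j hne) hi hj

theorem isBelow_or (h : SweepPartition K) {i j : ι} (hne : i ≠ j) {t : ℝ}
    (hi : MeetsVertical (K i) t) (hj : MeetsVertical (K j) t) : IsBelow K i j ∨ IsBelow K j i := by
  obtain ⟨y, hy⟩ := hi
  obtain ⟨z, hz⟩ := hj
  rcases lt_trichotomy y z with hlt | rfl | hlt
  · exact Or.inl ⟨hne, t, y, z, hy, hz, hlt⟩
  · exact absurd (h.eq_of_mem hy hz) hne
  · exact Or.inr ⟨hne.symm, t, z, y, hz, hy, hlt⟩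

theorem isBelow_asymm (h : SweepPartition K) {i j : ι} (hij : IsBelow K i j) :
    ¬ IsBelow K j i := by
  intro hji
  obtain ⟨hne, t, y, z, h1, h2, h3⟩ := hji
  exact lt_asymm h3 (h.lt_of_isBelow hij h2 h1)

theorem isBelow_trans (h : SweepPartition K) {i j k : ι} (hij : IsBelow K i j)
    (hjk : IsBelow K j k) {t : ℝ} (hi : MeetsVertical (K i) t) (hj : MeetsVertical (K j) t)
    (hk : MeetsVertical (K k) t) : IsBelow K i k := by
  have hne : i ≠ k := by
    rintro rfl
    exact h.isBelow_asymm hij hjk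
  obtain ⟨y, hy⟩ := hi
  obtain ⟨z, hz⟩ := hj
  obtain ⟨w, hw⟩ := hk
  exact ⟨hne, t, y, w, hy, hw, (h.lt_of_isBelow hij hy hz).trans (h.lt_of_isBelow hjk hz hw)⟩

theorem exists_frequently [Finite ι] (u : ℕ → ℝ × ℝ)
    (hu : ∃ᶠ m in atTop, u m ∉ (⋃ i, K i)ᶜ) : ∃ i, ∃ᶠ m in atTop, u m ∈ K i := by
  by_contra hc
  simp only [not_exists, not_frequently] at hc
  have := eventually_all.2 hc
  refine hu (this.mono fun m hm => ?_)
  simpa using hm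

/-- Some set contains infinitely many terms of a sequence increasing to `s` on its vertical line;
convexity fills the gaps. -/
theorem exists_neighbour_below [Finite ι] (h : SweepPartition K) {s : ℝ × ℝ}
    (hs : s ∈ (⋃ i, K i)ᶜ) : ∃ i, ∃ ε > 0, ∀ y, s.2 - ε < y → y < s.2 → (s.1, y) ∈ K i := by
  obtain ⟨i, hi⟩ := exists_frequently (K := K) (fun m : ℕ => (s.1, s.2 - 1 / ((m : ℝ) + 1))) (by
    refine Frequently.of_forall fun m hm => ?_
    have := h.injOn_fst hm hs rfl
    have h2 := congrArg Prod.snd this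
    have : (0 : ℝ) < 1 / ((m : ℝ) + 1) := by positivity
    simp only at h2
    linarith)
  obtain ⟨m, hm⟩ := hi.exists
  refine ⟨i, 1 / ((m : ℝ) + 1), by positivity, fun y h1 h2 => ?_⟩
  have ht : Tendsto (fun m : ℕ => s.2 - 1 / ((m : ℝ) + 1)) atTop (𝓝 (s.2 - 0)) :=
    tendsto_const_nhds.sub tendsto_one_div_add_atTop_nhds_zero_nat
  rw [sub_zero] at ht
  obtain ⟨m', hm', hm2⟩ := (hi.and_eventually (ht.eventually (lt_mem_nhds h2))).exists
  exact mem_of_vertical_between (h.convex i) hm hm' h1.le hm2.le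

theorem exists_neighbour_above [Finite ι] (h : SweepPartition K) {s : ℝ × ℝ}
    (hs : s ∈ (⋃ i, K i)ᶜ) : ∃ i, ∃ ε > 0, ∀ y, s.2 < y → y < s.2 + ε → (s.1, y) ∈ K i := by
  obtain ⟨i, hi⟩ := exists_frequently (K := K) (fun m : ℕ => (s.1, s.2 + 1 / ((m : ℝ) + 1))) (by
    refine Frequently.of_forall fun m hm => ?_
    have := h.injOn_fst hm hs rfl
    have h2 := congrArg Prod.snd this
    have : (0 : ℝ) < 1 / ((m : ℝ) + 1) := by positivity
    simp only at h2
    linarith)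
  obtain ⟨m, hm⟩ := hi.exists
  refine ⟨i, 1 / ((m : ℝ) + 1), by positivity, fun y h1 h2 => ?_⟩
  have ht : Tendsto (fun m : ℕ => s.2 + 1 / ((m : ℝ) + 1)) atTop (𝓝 (s.2 + 0)) :=
    tendsto_const_nhds.add tendsto_one_div_add_atTop_nhds_zero_nat
  rw [add_zero] at ht
  obtain ⟨m', hm', hm2⟩ := (hi.and_eventually (ht.eventually (gt_mem_nhds h1))).exists
  exact mem_of_vertical_between (h.convex i) hm' hm hm2.le h2.le

theorem exists_isNeighbourPair [Finite ι] (h : SweepPartition K) {s : ℝ × ℝ}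
    (hs : s ∈ (⋃ i, K i)ᶜ) : ∃ a b, IsNeighbourPair K s a b := by
  obtain ⟨a, ha⟩ := h.exists_neighbour_below hs
  obtain ⟨b, hb⟩ := h.exists_neighbour_above hs
  exact ⟨a, b, ha, hb⟩

theorem exists_top [Finite ι] (h : SweepPartition K) :
    ∃ i, ∀ t, ∃ y, ∀ z, y ≤ z → (t, z) ∈ K i := by
  have key : ∀ t, ∃ i, ∃ y, ∀ z, y ≤ z → (t, z) ∈ K i := by
    intro t
    obtain ⟨i, hi⟩ := exists_frequently (K := K) (fun m : ℕ => (t, (m : ℝ))) (by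
      have : {m : ℕ | (t, (m : ℝ)) ∈ (⋃ i, K i)ᶜ}.Finite :=
        h.finite.preimage fun _ _ _ _ e => Nat.cast_injective (Prod.mk.inj e).2
      have := this.eventually_cofinite_notMem
      rw [Nat.cofinite_eq_atTop] at this
      exact this.frequently)
    obtain ⟨m, hm⟩ := hi.exists
    refine ⟨i, m, fun z hz => ?_⟩
    obtain ⟨m', hm', hm2⟩ :=
      (hi.and_eventually (tendsto_natCast_atTop_atTop.eventually (eventually_ge_atTop z))).exists
    exact mem_of_vertical_between (h.convex i) hm hm' hz hm2
  obtain ⟨i, y, hi⟩ := key 0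
  refine ⟨i, fun t => ?_⟩
  obtain ⟨j, y', hj⟩ := key t
  obtain rfl := h.eq_of_up i j 0 t y y' hi hj
  exact ⟨y', hj⟩

theorem exists_bottom [Finite ι] (h : SweepPartition K) :
    ∃ i, ∀ t, ∃ y, ∀ z, z ≤ y → (t, z) ∈ K i := by
  have key : ∀ t, ∃ i, ∃ y, ∀ z, z ≤ y → (t, z) ∈ K i := by
    intro t
    obtain ⟨i, hi⟩ := exists_frequently (K := K) (fun m : ℕ => (t, -(m : ℝ))) (by
      have : {m : ℕ | (t, -(m : ℝ)) ∈ (⋃ i, K i)ᶜ}.Finite :=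
        h.finite.preimage fun _ _ _ _ e =>
          Nat.cast_injective (neg_injective (Prod.mk.inj e).2)
      have := this.eventually_cofinite_notMem
      rw [Nat.cofinite_eq_atTop] at this
      exact this.frequently)
    obtain ⟨m, hm⟩ := hi.exists
    refine ⟨i, -m, fun z hz => ?_⟩
    obtain ⟨m', hm', hm2⟩ :=
      (hi.and_eventually (tendsto_natCast_atTop_atTop.eventually
        (eventually_ge_atTop (-z)))).exists
    exact mem_of_vertical_between (h.convex i) hm' hm (by linarith) hz
  obtain ⟨i, y, hi⟩ := key 0
  refine ⟨i, fun t => ?_⟩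
  obtain ⟨j, y', hj⟩ := key t
  obtain rfl := h.eq_of_down i j 0 t y y' hi hj
  exact ⟨y', hj⟩

theorem _root_.IsNeighbourPair.meets_left {s : ℝ × ℝ} {a b : ι} (hp : IsNeighbourPair K s a b) :
    MeetsVertical (K a) s.1 := by
  obtain ⟨⟨ε, hε, h⟩, -⟩ := hp
  exact ⟨s.2 - ε / 2, h _ (by linarith) (by linarith)⟩

theorem _root_.IsNeighbourPair.meets_right {s : ℝ × ℝ} {a b : ι} (hp : IsNeighbourPair K s a b) :
    MeetsVertical (K b) s.1 := by
  obtain ⟨-, ⟨ε, hε, h⟩⟩ := hp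
  exact ⟨s.2 + ε / 2, h _ (by linarith) (by linarith)⟩

theorem isBelow_of_pair (h : SweepPartition K) {s : ℝ × ℝ} (hs : s ∈ (⋃ i, K i)ᶜ) {a b : ι}
    (hp : IsNeighbourPair K s a b) : IsBelow K a b := by
  obtain ⟨⟨ε, hε, h1⟩, ⟨δ, hδ, h2⟩⟩ := hp
  have m1 := h1 (s.2 - ε / 2) (by linarith) (by linarith)
  have m2 := h2 (s.2 + δ / 2) (by linarith) (by linarith)
  refine ⟨?_, s.1, _, _, m1, m2, by linarith⟩
  rintro rfl
  have := mem_of_vertical_between (h.convex a) m1 m2 (z := s.2) (by linarith) (by linarith)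
  exact hs (mem_iUnion.2 ⟨a, this⟩)

/-- Nothing lies between the neighbours of an uncovered point on its vertical line. -/
theorem not_meets_of_between (h : SweepPartition K) {s : ℝ × ℝ} (hs : s ∈ (⋃ i, K i)ᶜ) {a b c : ι}
    (hp : IsNeighbourPair K s a b) (hac : IsBelow K a c) (hcb : IsBelow K c b) :
    ¬ MeetsVertical (K c) s.1 := by
  rintro ⟨y, hy⟩
  obtain ⟨⟨ε, hε, h1⟩, ⟨δ, hδ, h2⟩⟩ := hp
  rcases lt_trichotomy y s.2 with hlt | heq | hlt
  · have := h.lt_of_isBelow hac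
      (h1 (max y (s.2 - ε / 2)) (lt_max_of_lt_right (by linarith)) (max_lt hlt (by linarith))) hy
    exact absurd (le_max_left y (s.2 - ε / 2)) (not_le.2 this)
  · exact hs (mem_iUnion.2 ⟨c, by rw [heq] at hy; exact hy⟩)
  · have := h.lt_of_isBelow hcb hy
      (h2 (min y (s.2 + δ / 2)) (lt_min hlt (by linarith)) (min_lt_of_right_lt (by linarith)))
    exact absurd (min_le_left y (s.2 + δ / 2)) (not_le.2 this)

theorem disjoint_closure_interior (h : SweepPartition K) {i j : ι} (hne : i ≠ j) {p : ℝ × ℝ}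
    (hi : p ∈ closure (K i)) (hj : p ∈ interior (K j)) : False := by
  obtain ⟨q, hq1, hq2⟩ := mem_closure_iff.1 hi _ isOpen_interior hj
  exact hne (h.eq_of_mem hq2 (interior_subset hq1))

theorem interior_below (h : SweepPartition K) {s : ℝ × ℝ} (hs : s ∈ (⋃ i, K i)ᶜ) {a b : ι}
    (hp : IsNeighbourPair K s a b) : ∃ ε > 0, ∀ y, s.2 - ε < y → y < s.2 →
      (s.1, y) ∈ interior (K a) := by
  obtain ⟨hl, hr⟩ := h.crosses s hs a hp.meets_left
  obtain ⟨⟨ε, hε, h1⟩, -⟩ := hp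
  refine ⟨ε, hε, fun y hy1 hy2 => ?_⟩
  exact mem_interior_of_vertical_chord (h.convex a)
    (h1 ((s.2 - ε + y) / 2) (by linarith) (by linarith)) (h1 ((s.2 + y) / 2)
    (by linarith) (by linarith)) (by linarith) (by linarith) hl hr

theorem interior_above (h : SweepPartition K) {s : ℝ × ℝ} (hs : s ∈ (⋃ i, K i)ᶜ) {a b : ι}
    (hp : IsNeighbourPair K s a b) : ∃ ε > 0, ∀ y, s.2 < y → y < s.2 + ε →
      (s.1, y) ∈ interior (K b) := by
  obtain ⟨hl, hr⟩ := h.crosses s hs b hp.meets_right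
  obtain ⟨-, ⟨ε, hε, h1⟩⟩ := hp
  refine ⟨ε, hε, fun y hy1 hy2 => ?_⟩
  exact mem_interior_of_vertical_chord (h.convex b)
    (h1 ((s.2 + y) / 2) (by linarith) (by linarith)) (h1 ((s.2 + ε + y) / 2)
    (by linarith) (by linarith)) (by linarith) (by linarith) hl hr

/-- Otherwise the vertical segment from a point of `K c` to `s` would lie in the closure of `K c`
and enter the interior of `K a` or `K b` next to `s`. -/
theorem notMem_closure_of_meets (h : SweepPartition K) {s : ℝ × ℝ} (hs : s ∈ (⋃ i, K i)ᶜ)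
    {a b c : ι} (hp : IsNeighbourPair K s a b) (hca : c ≠ a) (hcb : c ≠ b)
    (hc : MeetsVertical (K c) s.1) : s ∉ closure (K c) := by
  intro hcl
  obtain ⟨y, hy⟩ := hc
  have hcv := (h.convex c).closure
  rcases lt_trichotomy y s.2 with hlt | heq | hlt
  · obtain ⟨ε, hε, hi⟩ := h.interior_below hs hp
    have hm := hi (max y (s.2 - ε / 2)) (lt_max_of_lt_right (by linarith))
      (max_lt hlt (by linarith))
    exact h.disjoint_closure_interior hca (mem_of_vertical_between hcv (subset_closure hy) hcl
      (le_max_left _ _) (max_le hlt.le (by linarith))) hm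
  · exact hs (mem_iUnion.2 ⟨c, by rw [heq] at hy; exact hy⟩)
  · obtain ⟨ε, hε, hi⟩ := h.interior_above hs hp
    have hm := hi (min y (s.2 + ε / 2)) (lt_min hlt (by linarith))
      (min_lt_of_right_lt (by linarith))
    exact h.disjoint_closure_interior hcb (mem_of_vertical_between hcv hcl (subset_closure hy)
      (le_min hlt.le (by linarith)) (min_le_left _ _)) hm

end SweepPartition

/-! ### Birth, death and edge points, and what they are charged to. -/

theorem Set.ncard_le_ncard_of_rel {α β : Type*} {X : Set α} {Y : Set β} (hY : Y.Finite)
    (R : α → β → Prop) (h1 : ∀ x ∈ X, ∃ y ∈ Y, R x y)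
    (h2 : ∀ x ∈ X, ∀ x' ∈ X, ∀ y, R x y → R x' y → x = x') : X.ncard ≤ Y.ncard := by
  rcases X.eq_empty_or_nonempty with rfl | ⟨x₀, hx₀⟩
  · simp
  have : Nonempty β := ⟨(h1 x₀ hx₀).choose⟩
  choose! f hf using h1
  exact Set.ncard_le_ncard_of_injOn f (fun x hx => (hf x hx).1)
    (fun x hx x' hx' e => h2 x hx x' hx' (f x) (hf x hx).2 (e ▸ (hf x' hx').2)) hY

/-- The indices of the sets that are unbounded to the left. -/
def leftUnbounded {ι : Type*} (K : ι → Set (ℝ × ℝ)) : Set ι := {i | ∀ c, ∃ p ∈ K i, p.1 < c}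

/-- The indices of the sets that are unbounded to the right. -/
def rightUnbounded {ι : Type*} (K : ι → Set (ℝ × ℝ)) : Set ι := {i | ∀ c, ∃ p ∈ K i, c < p.1}

/-- The uncovered points adherent to a set lying strictly to their right. -/
def birthPoints {ι : Type*} (K : ι → Set (ℝ × ℝ)) : Set (ℝ × ℝ) :=
  {s ∈ (⋃ i, K i)ᶜ | ∃ c, s ∈ closure (K c) ∧ ∀ p ∈ K c, s.1 < p.1}

/-- The uncovered points adherent to a set lying strictly to their left. -/
def deathPoints {ι : Type*} (K : ι → Set (ℝ × ℝ)) : Set (ℝ × ℝ) :=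
  {s ∈ (⋃ i, K i)ᶜ | ∃ c, s ∈ closure (K c) ∧ ∀ p ∈ K c, p.1 < s.1}

/-- The remaining uncovered points. -/
def edgePoints {ι : Type*} (K : ι → Set (ℝ × ℝ)) : Set (ℝ × ℝ) :=
  (⋃ i, K i)ᶜ \ (birthPoints K ∪ deathPoints K)

namespace SweepPartition

variable {ι : Type*} {K : ι → Set (ℝ × ℝ)}

/-- The set `c` determines the point, since `s.1` is the infimum of the abscissas in `K c` and
distinct uncovered points have distinct abscissas. -/
theorem ncard_birthPoints_le [Finite ι] (h : SweepPartition K) :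
    (birthPoints K).ncard ≤ (leftUnbounded K)ᶜ.ncard := by
  refine Set.ncard_le_ncard_of_rel (Set.toFinite _)
    (fun s c => s ∈ closure (K c) ∧ ∀ p ∈ K c, s.1 < p.1) ?_ ?_
  · rintro s ⟨-, c, hc, hr⟩
    refine ⟨c, fun hu => ?_, hc, hr⟩
    obtain ⟨p, hp, hlt⟩ := hu s.1
    exact lt_asymm hlt (hr p hp)
  · rintro s hs s' hs' c ⟨h1, h2⟩ ⟨h3, h4⟩
    refine h.injOn_fst hs.1 hs'.1 (le_antisymm ?_ ?_)
    · exact closure_minimal (fun p hp => (h2 p hp).le : K c ⊆ {p | s.1 ≤ p.1})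
        (isClosed_le continuous_const continuous_fst) h3
    · exact closure_minimal (fun p hp => (h4 p hp).le : K c ⊆ {p | s'.1 ≤ p.1})
        (isClosed_le continuous_const continuous_fst) h1

theorem ncard_deathPoints_le [Finite ι] (h : SweepPartition K) :
    (deathPoints K).ncard ≤ (rightUnbounded K)ᶜ.ncard := by
  refine Set.ncard_le_ncard_of_rel (Set.toFinite _)
    (fun s c => s ∈ closure (K c) ∧ ∀ p ∈ K c, p.1 < s.1) ?_ ?_
  · rintro s ⟨-, c, hc, hr⟩
    refine ⟨c, fun hu => ?_, hc, hr⟩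
    obtain ⟨p, hp, hlt⟩ := hu s.1
    exact lt_asymm hlt (hr p hp)
  · rintro s hs s' hs' c ⟨h1, h2⟩ ⟨h3, h4⟩
    refine h.injOn_fst hs.1 hs'.1 (le_antisymm ?_ ?_)
    · exact closure_minimal (fun p hp => (h4 p hp).le : K c ⊆ {p | p.1 ≤ s'.1})
        (isClosed_le continuous_fst continuous_const) h1
    · exact closure_minimal (fun p hp => (h2 p hp).le : K c ⊆ {p | p.1 ≤ s.1})
        (isClosed_le continuous_fst continuous_const) h3

theorem meets_of_mem_closure (h : SweepPartition K) {s : ℝ × ℝ} (hs : s ∈ edgePoints K) {c : ι}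
    (hc : s ∈ closure (K c)) : MeetsVertical (K c) s.1 := by
  by_contra hm
  have h1 : ¬ ∀ p ∈ K c, s.1 < p.1 := fun hr => hs.2 (Or.inl ⟨hs.1, c, hc, hr⟩)
  have h2 : ¬ ∀ p ∈ K c, p.1 < s.1 := fun hr => hs.2 (Or.inr ⟨hs.1, c, hc, hr⟩)
  push Not at h1 h2
  obtain ⟨p, hp, hp'⟩ := h1
  obtain ⟨q, hq, hq'⟩ := h2
  exact hm (MeetsVertical.of_between (h.convex c) ⟨p.2, hp⟩ ⟨q.2, hq⟩ hp' hq')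

theorem eventually_mem_pair [Finite ι] (h : SweepPartition K) {s : ℝ × ℝ} (hs : s ∈ edgePoints K)
    {a b : ι} (hp : IsNeighbourPair K s a b) :
    ∀ᶠ p in 𝓝 s, p ≠ s → p ∈ K a ∨ p ∈ K b := by
  have h1 : ∀ c, ∀ᶠ p in 𝓝 s, c ≠ a → c ≠ b → p ∉ K c := by
    intro c
    by_cases hc : c ≠ a ∧ c ≠ b
    · have : s ∉ closure (K c) := fun hcl => h.notMem_closure_of_meets hs.1 hp hc.1 hc.2
        (h.meets_of_mem_closure hs hcl) hcl
      filter_upwards [isClosed_closure.isOpen_compl.mem_nhds this] with p hp _ _ hpc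
      exact hp (subset_closure hpc)
    · exact Eventually.of_forall fun p h1 h2 => absurd ⟨h1, h2⟩ hc
  have h2 : ∀ᶠ p in 𝓝 s, p ∉ (⋃ i, K i)ᶜ \ {s} :=
    h.finite.sdiff.isClosed.isOpen_compl.mem_nhds (fun hm => hm.2 rfl)
  filter_upwards [eventually_all.2 h1, h2] with p hp1 hp2 hne
  have : p ∈ ⋃ i, K i := by
    by_contra hc
    exact hp2 ⟨hc, hne⟩
  obtain ⟨c, hc⟩ := mem_iUnion.1 this
  by_cases ha : c = a
  · exact Or.inl (ha ▸ hc)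
  by_cases hb : c = b
  · exact Or.inr (hb ▸ hc)
  exact absurd hc (hp1 c ha hb)

/-- On the line through `s` and `s'`, three points, one just before `s` and one on each side of
`s'`, lie in the two sets. Two share a set, yet any two of them have `s` or `s'` between them. -/
theorem eq_of_pair [Finite ι] (h : SweepPartition K) {s s' : ℝ × ℝ} (hs : s ∈ edgePoints K)
    (hs' : s' ∈ edgePoints K) {a b : ι} (hp : IsNeighbourPair K s a b)
    (hp' : IsNeighbourPair K s' a b) : s = s' := by
  by_contra hne
  have hd : s' - s ≠ 0 := sub_ne_zero.2 (Ne.symm hne)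
  let L : ℝ → ℝ × ℝ := fun r => s + r • (s' - s)
  have hL0 : L 0 = s := by simp [L]
  have hL1 : L 1 = s' := by simp [L]
  have hinj : Function.Injective L := fun r r' e => by
    simpa [L, hd] using e
  have hcont : Continuous L := by fun_prop
  have hconv : ∀ {i : ι} {r u v : ℝ}, L r ∈ K i → L v ∈ K i → r < u → u < v → L u ∈ K i := by
    intro i r u v h1 h2 h3 h4
    have hpos : 0 < v - r := by linarith
    have := (h.convex i) h1 h2 (a := (v - u) / (v - r)) (b := (u - r) / (v - r))
      (div_nonneg (by linarith) hpos.le) (div_nonneg (by linarith) hpos.le) (by field_simp; ring)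
    convert this using 1
    ext
    · simp [L]; field_simp; ring
    · simp [L]; field_simp; ring
  have e0 : ∀ᶠ r in 𝓝 (0 : ℝ), r ≠ 0 → L r ∈ K a ∨ L r ∈ K b := by
    have := (hcont.tendsto' 0 _ hL0).eventually (h.eventually_mem_pair hs hp)
    filter_upwards [this] with r hr hr0
    exact hr fun e => hr0 (hinj (e.trans hL0.symm))
  have e1 : ∀ᶠ r in 𝓝 (1 : ℝ), r ≠ 1 → L r ∈ K a ∨ L r ∈ K b := by
    have := (hcont.tendsto' 1 _ hL1).eventually (h.eventually_mem_pair hs' hp')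
    filter_upwards [this] with r hr hr0
    exact hr fun e => hr0 (hinj (e.trans hL1.symm))
  obtain ⟨δ, hδ, h0⟩ := Metric.eventually_nhds_iff.1 e0
  obtain ⟨δ', hδ', h1⟩ := Metric.eventually_nhds_iff.1 e1
  obtain ⟨η, hη, hηm⟩ : ∃ η > 0, η < min (min δ δ') (1 / 2) :=
    ⟨min (min δ δ') (1 / 2) / 2, by positivity, half_lt_self (by positivity)⟩
  rw [lt_min_iff, lt_min_iff] at hηm
  obtain ⟨⟨hη1, hη2⟩, hη3⟩ := hηm
  have hs0 : ∀ i, L 0 ∉ K i := fun i hi => hs.1 (mem_iUnion.2 ⟨i, hL0 ▸ hi⟩)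
  have hs1 : ∀ i, L 1 ∉ K i := fun i hi => hs'.1 (mem_iUnion.2 ⟨i, hL1 ▸ hi⟩)
  have p1 := h0 (y := -η) (by simp [abs_of_pos hη, hη1]) (by linarith)
  have p3 := h1 (y := 1 - η) (by simp [abs_of_pos hη, hη2]) (by linarith)
  have p4 := h1 (y := 1 + η) (by simp [abs_of_pos hη, hη2]) (by linarith)
  have n13 : ∀ i, L (-η) ∈ K i → L (1 - η) ∉ K i := fun i h1 h2 =>
    hs0 i (hconv h1 h2 (by linarith) (by linarith))
  have n14 : ∀ i, L (-η) ∈ K i → L (1 + η) ∉ K i := fun i h1 h2 =>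
    hs0 i (hconv h1 h2 (by linarith) (by linarith))
  have n34 : ∀ i, L (1 - η) ∈ K i → L (1 + η) ∉ K i := fun i h1 h2 =>
    hs1 i (hconv h1 h2 (by linarith) (by linarith))
  rcases p1 with p1 | p1
  · exact n34 b (p3.resolve_left (n13 a p1)) (p4.resolve_left (n14 a p1))
  · exact n34 a (p3.resolve_right (n13 b p1)) (p4.resolve_right (n14 b p1))

/-- The point is charged to `a`, born no earlier than `b`. If `a` had two such upper partners `b`
and `b'`, both would be present with `a` on a line left of both points, and the lower one would lie
between `a` and the other. The top set is never charged, having nothing above it. -/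
theorem ncard_edgePoints_of_late_birth_above [Finite ι] (h : SweepPartition K) {T : ι}
    (hT : ∀ t, ∃ y, ∀ z, y ≤ z → (t, z) ∈ K T) :
    {s ∈ edgePoints K | ∃ a b, IsNeighbourPair K s a b ∧ (∀ c, ¬ IsMid K a b s.1 c) ∧
      ∀ t, MeetsVertical (K a) t → ∃ t' ≤ t, MeetsVertical (K b) t'}.ncard
      ≤ ({T}ᶜ : Set ι).ncard := by
  refine Set.ncard_le_ncard_of_rel (Set.toFinite _) (fun s a => ∃ b, IsNeighbourPair K s a b ∧
    (∀ c, ¬ IsMid K a b s.1 c) ∧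
      ∀ t, MeetsVertical (K a) t → ∃ t' ≤ t, MeetsVertical (K b) t') ?_ ?_
  · rintro s ⟨hs, a, b, hp, hr⟩
    refine ⟨a, ?_, b, hp, hr⟩
    rintro rfl
    have hb := h.isBelow_of_pair hs.1 hp
    obtain ⟨y, hy⟩ := hT s.1
    obtain ⟨z, hz⟩ := hp.meets_right
    have := h.lt_of_isBelow hb (hy (max y z) (le_max_left _ _)) hz
    exact absurd (le_max_right y z) (not_le.2 this)
  · rintro s hs s' hs' a ⟨b, hp, hm, hb⟩ ⟨b', hp', hm', hb'⟩
    obtain ⟨t, ht, ht1, ht2⟩ : ∃ t, MeetsVertical (K a) t ∧ t < s.1 ∧ t < s'.1 := by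
      rcases le_total s.1 s'.1 with hle | hle
      · obtain ⟨⟨p, hp, hlt⟩, -⟩ := h.crosses s hs.1.1 a hp.meets_left
        exact ⟨p.1, ⟨p.2, hp⟩, hlt, hlt.trans_le hle⟩
      · obtain ⟨⟨p, hp, hlt⟩, -⟩ := h.crosses s' hs'.1.1 a hp'.meets_left
        exact ⟨p.1, ⟨p.2, hp⟩, hlt.trans_le hle, hlt⟩
    have mb : MeetsVertical (K b) t := by
      obtain ⟨r, hr, hrm⟩ := hb t ht
      exact MeetsVertical.of_between (h.convex b) hrm hp.meets_right hr ht1.le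
    have mb' : MeetsVertical (K b') t := by
      obtain ⟨r, hr, hrm⟩ := hb' t ht
      exact MeetsVertical.of_between (h.convex b') hrm hp'.meets_right hr ht2.le
    have hbb : b = b' := by
      by_contra hne
      rcases h.isBelow_or hne mb mb' with hlt | hlt
      · exact hm' b ⟨h.isBelow_of_pair hs.1.1 hp, hlt, t, ht2, ht, mb', mb⟩
      · exact hm b' ⟨h.isBelow_of_pair hs'.1.1 hp', hlt, t, ht1, ht, mb, mb'⟩
    exact h.eq_of_pair hs.1 hs'.1 hp (hbb ▸ hp')

/-- The mirror case, charged to `b`: being born strictly after `a`, it is bounded to the left. -/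
theorem ncard_edgePoints_of_late_birth_below [Finite ι] (h : SweepPartition K) :
    {s ∈ edgePoints K | ∃ a b, IsNeighbourPair K s a b ∧ (∀ c, ¬ IsMid K a b s.1 c) ∧
      ∃ t, MeetsVertical (K a) t ∧ ∀ t', MeetsVertical (K b) t' → t < t'}.ncard
      ≤ (leftUnbounded K)ᶜ.ncard := by
  refine Set.ncard_le_ncard_of_rel (Set.toFinite _) (fun s b => ∃ a, IsNeighbourPair K s a b ∧
    (∀ c, ¬ IsMid K a b s.1 c) ∧
      ∃ t, MeetsVertical (K a) t ∧ ∀ t', MeetsVertical (K b) t' → t < t') ?_ ?_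
  · rintro s ⟨hs, a, b, hp, hm, t, ht, htb⟩
    refine ⟨b, fun hu => ?_, a, hp, hm, t, ht, htb⟩
    obtain ⟨p, hp, hlt⟩ := hu t
    exact lt_asymm hlt (htb p.1 ⟨p.2, hp⟩)
  · rintro s hs s' hs' b ⟨a, hp, hm, r, hr, hb⟩ ⟨a', hp', hm', r', hr', hb'⟩
    obtain ⟨t, ht, ht1, ht2⟩ : ∃ t, MeetsVertical (K b) t ∧ t < s.1 ∧ t < s'.1 := by
      rcases le_total s.1 s'.1 with hle | hle
      · obtain ⟨⟨p, hp, hlt⟩, -⟩ := h.crosses s hs.1.1 b hp.meets_right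
        exact ⟨p.1, ⟨p.2, hp⟩, hlt, hlt.trans_le hle⟩
      · obtain ⟨⟨p, hp, hlt⟩, -⟩ := h.crosses s' hs'.1.1 b hp'.meets_right
        exact ⟨p.1, ⟨p.2, hp⟩, hlt.trans_le hle, hlt⟩
    have ma : MeetsVertical (K a) t :=
      MeetsVertical.of_between (h.convex a) hr hp.meets_left (hb t ht).le ht1.le
    have ma' : MeetsVertical (K a') t :=
      MeetsVertical.of_between (h.convex a') hr' hp'.meets_left (hb' t ht).le ht2.le
    have haa : a = a' := by
      by_contra hne
      rcases h.isBelow_or hne ma ma' with hlt | hlt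
      · exact hm a' ⟨hlt, h.isBelow_of_pair hs'.1.1 hp', t, ht1, ma, ht, ma'⟩
      · exact hm' a ⟨hlt, h.isBelow_of_pair hs.1.1 hp, t, ht2, ma', ht, ma⟩
    exact h.eq_of_pair hs.1 hs'.1 hp (haa ▸ hp')

theorem lt_of_isMid (h : SweepPartition K) {s : ℝ × ℝ} (hs : s ∈ (⋃ i, K i)ᶜ) {a b c : ι}
    (hp : IsNeighbourPair K s a b) (hm : IsMid K a b s.1 c) {u : ℝ} (hu : MeetsVertical (K c) u) :
    u < s.1 := by
  obtain ⟨h1, h2, t, ht, -, -, hct⟩ := hm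
  by_contra hle
  exact h.not_meets_of_between hs hp h1 h2
    (MeetsVertical.of_between (h.convex c) hct hu ht.le (not_lt.1 hle))

theorem bddAbove_of_isMid (h : SweepPartition K) {s : ℝ × ℝ} (hs : s ∈ (⋃ i, K i)ᶜ) {a b c : ι}
    (hp : IsNeighbourPair K s a b) (hm : IsMid K a b s.1 c) :
    BddAbove {t | MeetsVertical (K c) t} :=
  ⟨s.1, fun _ hu => (h.lt_of_isMid hs hp hm hu).le⟩

/-- The set between `K a` and `K b` that dies last determines both. -/
theorem not_isBelow_of_isMid (h : SweepPartition K) {s s' : ℝ × ℝ} (hs : s ∈ (⋃ i, K i)ᶜ)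
    (hs' : s' ∈ (⋃ i, K i)ᶜ) {a b a' b' c x : ι} (hp : IsNeighbourPair K s a b)
    (hp' : IsNeighbourPair K s' a' b') (hm : IsMid K a b s.1 c) (hm' : IsMid K a' b' s'.1 c)
    (hmax : ∀ c', IsMid K a b s.1 c' →
      sSup {t | MeetsVertical (K c') t} ≤ sSup {t | MeetsVertical (K c) t})
    (hx : MeetsVertical (K x) s'.1) (hmx : IsMid K a b s.1 x) : False := by
  obtain ⟨-, p, hpx, hlt⟩ := h.crosses s' hs' x hx
  have h1 : p.1 ≤ sSup {t | MeetsVertical (K x) t} :=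
    le_csSup (h.bddAbove_of_isMid hs hp hmx) ⟨p.2, hpx⟩
  obtain ⟨_, _, t, _, _, _, hct⟩ := hm
  have h2 : sSup {t | MeetsVertical (K c) t} ≤ s'.1 :=
    csSup_le ⟨t, hct⟩ fun u hu => (h.lt_of_isMid hs' hp' hm' hu).le
  linarith [hmax x hmx]

/-- The point is charged to the set between `a` and `b` that dies last. -/
theorem ncard_edgePoints_of_isMid [Finite ι] (h : SweepPartition K) :
    {s ∈ edgePoints K | ∃ a b, IsNeighbourPair K s a b ∧ ∃ c, IsMid K a b s.1 c}.ncard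
      ≤ (rightUnbounded K)ᶜ.ncard := by
  refine Set.ncard_le_ncard_of_rel (Set.toFinite _) (fun s c => ∃ a b, IsNeighbourPair K s a b ∧
    IsMid K a b s.1 c ∧ ∀ c', IsMid K a b s.1 c' →
      sSup {t | MeetsVertical (K c') t} ≤ sSup {t | MeetsVertical (K c) t}) ?_ ?_
  · rintro s ⟨hs, a, b, hp, hex⟩
    obtain ⟨c, hc, hmax⟩ := Set.exists_max_image {c | IsMid K a b s.1 c}
      (fun c => sSup {t | MeetsVertical (K c) t}) (Set.toFinite _) hex
    refine ⟨c, fun hu => ?_, a, b, hp, hc, hmax⟩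
    obtain ⟨p, hpc, hlt⟩ := hu s.1
    exact lt_asymm hlt (h.lt_of_isMid hs.1 hp hc ⟨p.2, hpc⟩)
  · rintro s ⟨hs, -⟩ s' ⟨hs', -⟩ c ⟨a, b, hp, hm, hmax⟩ ⟨a', b', hp', hm', hmax'⟩
    have hm0 := hm
    have hm0' := hm'
    obtain ⟨hac, hcb, t, ht, hta, htb, htc⟩ := hm
    obtain ⟨hac', hcb', t', ht', hta', htb', htc'⟩ := hm'
    obtain ⟨u, huc, htu, htu'⟩ : ∃ u, MeetsVertical (K c) u ∧ t ≤ u ∧ t' ≤ u := by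
      rcases le_total t t' with hle | hle
      · exact ⟨t', htc', hle, le_rfl⟩
      · exact ⟨t, htc, le_rfl, hle⟩
    have hus := h.lt_of_isMid hs.1 hp hm0 huc
    have hus' := h.lt_of_isMid hs'.1 hp' hm0' huc
    have ua := MeetsVertical.of_between (h.convex a) hta hp.meets_left htu hus.le
    have ub := MeetsVertical.of_between (h.convex b) htb hp.meets_right htu hus.le
    have ua' := MeetsVertical.of_between (h.convex a') hta' hp'.meets_left htu' hus'.le
    have ub' := MeetsVertical.of_between (h.convex b') htb' hp'.meets_right htu' hus'.le
    have haa : a = a' := by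
      by_contra hne
      rcases h.isBelow_or hne ua ua' with hlt | hlt
      -- Here `a'` lies between `a` and `b` and survives past `s'`, whereas `c`, supposedly the last
      -- to die, is dead by then. The other three cases are alike.
      · exact h.not_isBelow_of_isMid hs.1 hs'.1 hp hp' hm0 hm0' hmax hp'.meets_left
          ⟨hlt, h.isBelow_trans hac' hcb ua' huc ub, u, hus, ua, ub, ua'⟩
      · exact h.not_isBelow_of_isMid hs'.1 hs.1 hp' hp hm0' hm0 hmax' hp.meets_left
          ⟨hlt, h.isBelow_trans hac hcb' ua huc ub', u, hus', ua', ub', ua⟩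
    have hbb : b = b' := by
      by_contra hne
      rcases h.isBelow_or hne ub ub' with hlt | hlt
      · exact h.not_isBelow_of_isMid hs'.1 hs.1 hp' hp hm0' hm0 hmax' hp.meets_right
          ⟨h.isBelow_trans hac' hcb ua' huc ub, hlt, u, hus', ua', ub', ub⟩
      · exact h.not_isBelow_of_isMid hs.1 hs'.1 hp hp' hm0 hm0' hmax hp'.meets_right
          ⟨h.isBelow_trans hac hcb' ua huc ub', hlt, u, hus, ua, ub, ub'⟩
    exact h.eq_of_pair hs hs' hp (haa ▸ hbb ▸ hp')

theorem ncard_edgePoints_le [Finite ι] (h : SweepPartition K) {T : ι}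
    (hT : ∀ t, ∃ y, ∀ z, y ≤ z → (t, z) ∈ K T) :
    (edgePoints K).ncard ≤ ({T}ᶜ : Set ι).ncard + (leftUnbounded K)ᶜ.ncard +
      (rightUnbounded K)ᶜ.ncard := by
  have hfin : (edgePoints K).Finite := h.finite.sdiff
  refine le_trans (Set.ncard_le_ncard (t := _ ∪ _ ∪ _) ?_ ?_) (((Set.ncard_union_le _ _).trans
    (Nat.add_le_add_right (Set.ncard_union_le _ _) _)).trans (Nat.add_le_add (Nat.add_le_add
    (h.ncard_edgePoints_of_late_birth_above hT) h.ncard_edgePoints_of_late_birth_below)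
      h.ncard_edgePoints_of_isMid))
  · intro s hs
    obtain ⟨a, b, hp⟩ := h.exists_isNeighbourPair hs.1
    by_cases hm : ∃ c, IsMid K a b s.1 c
    · exact Or.inr ⟨hs, a, b, hp, hm⟩
    push Not at hm
    by_cases hb : ∀ t, MeetsVertical (K a) t → ∃ t' ≤ t, MeetsVertical (K b) t'
    · exact Or.inl (Or.inl ⟨hs, a, b, hp, hm, hb⟩)
    · push Not at hb
      obtain ⟨t, ht, hb⟩ := hb
      refine Or.inl (Or.inr ⟨hs, a, b, hp, hm, t, ht, fun t' ht' => ?_⟩)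
      by_contra hle
      exact hb t' (not_lt.1 hle) ht'
  · exact ((hfin.subset (sep_subset _ _)).union (hfin.subset (sep_subset _ _))).union
      (hfin.subset (sep_subset _ _))

theorem ncard_compl_le_add (h : SweepPartition K) : (⋃ i, K i)ᶜ.ncard ≤
    (edgePoints K).ncard + (birthPoints K).ncard + (deathPoints K).ncard := by
  have : (⋃ i, K i)ᶜ ⊆ edgePoints K ∪ birthPoints K ∪ deathPoints K := by
    intro s hs
    by_cases h1 : s ∈ birthPoints K ∪ deathPoints K
    · rcases h1 with h1 | h1
      · exact Or.inl (Or.inr h1)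
      · exact Or.inr h1
    · exact Or.inl (Or.inl ⟨hs, h1⟩)
  refine (Set.ncard_le_ncard this ?_).trans ((Set.ncard_union_le _ _).trans
    (Nat.add_le_add_right (Set.ncard_union_le _ _) _))
  exact (h.finite.sdiff.union (h.finite.subset (sep_subset _ _))).union
    (h.finite.subset (sep_subset _ _))

end SweepPartition

/-! ### The case where only the top and bottom sets are unbounded sideways, and the final count. -/

namespace SweepPartition

variable {ι : Type*} {K : ι → Set (ℝ × ℝ)}

theorem exists_mem_closure_of_cover {X Y : Set (ℝ × ℝ)} {t y z : ℝ} (hy : (t, y) ∈ X)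
    (hz : (t, z) ∈ Y) (hc : ∀ w, (t, w) ∈ X ∨ (t, w) ∈ Y) :
    ∃ w, (t, w) ∈ closure X ∧ (t, w) ∈ closure Y := by
  have hcont : Continuous fun w : ℝ => (t, w) := by fun_prop
  obtain ⟨w, -, h1, h2⟩ := isPreconnected_closed_iff.1 (isPreconnected_univ (α := ℝ)) _ _
    (isClosed_closure.preimage hcont (t := closure X))
    (isClosed_closure.preimage hcont (t := closure Y))
    (fun w _ => (hc w).imp (fun h => subset_closure h) (fun h => subset_closure h))
    ⟨y, trivial, subset_closure hy⟩ ⟨z, trivial, subset_closure hz⟩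
  exact ⟨w, h1, h2⟩

theorem exists_mem_closure_of_filter [Finite ι] (h : SweepPartition K) {T B : ι}
    (hT : ∀ t, ∃ y, ∀ z, y ≤ z → (t, z) ∈ K T) (hB : ∀ t, ∃ y, ∀ z, z ≤ y → (t, z) ∈ K B)
    (l : Filter ℝ) [l.NeBot] (hl : l ≤ cofinite)
    (hi : ∀ i, i ≠ T → i ≠ B → ∀ᶠ t in l, ¬ MeetsVertical (K i) t) (P : ℝ → Prop)
    (hP : ∀ᶠ t in l, P t) : ∃ t y, P t ∧ (t, y) ∈ closure (K B) ∧ (t, y) ∈ closure (K T) := by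
  have h1 : ∀ᶠ t in l, ∀ i, i ≠ T → i ≠ B → ¬ MeetsVertical (K i) t := by
    refine eventually_all.2 fun i => ?_
    by_cases hT : i = T
    · exact Eventually.of_forall fun _ h1 => absurd hT h1
    by_cases hB : i = B
    · exact Eventually.of_forall fun _ _ h1 => absurd hB h1
    · filter_upwards [hi i hT hB] with t ht _ _ using ht
  have h2 : ∀ᶠ t in l, t ∉ Prod.fst '' (⋃ i, K i)ᶜ :=
    hl (h.finite.image Prod.fst).eventually_cofinite_notMem
  obtain ⟨t, ht, ht1, ht2⟩ := (hP.and (h1.and h2)).exists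
  obtain ⟨y, hy⟩ := hT t
  obtain ⟨z, hz⟩ := hB t
  obtain ⟨w, hw1, hw2⟩ := exists_mem_closure_of_cover (hz z le_rfl) (hy y le_rfl) (fun w => by
    have : (t, w) ∈ ⋃ i, K i := by
      by_contra hc
      exact ht2 ⟨(t, w), hc, rfl⟩
    obtain ⟨i, hi⟩ := mem_iUnion.1 this
    by_cases hiT : i = T
    · exact Or.inr (hiT ▸ hi)
    by_cases hiB : i = B
    · exact Or.inl (hiB ▸ hi)
    exact absurd ⟨w, hi⟩ (ht1 i hiT hiB))
  exact ⟨t, w, ht, hw1, hw2⟩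

/-- Far to the left and far to the right only `K B` and `K T` remain, so their closures meet there;
the intersection of the closures is convex and thus meets every vertical line in between. -/
theorem exists_mem_closure_bottom_top [Finite ι] (h : SweepPartition K) {T B : ι}
    (hT : ∀ t, ∃ y, ∀ z, y ≤ z → (t, z) ∈ K T) (hB : ∀ t, ∃ y, ∀ z, z ≤ y → (t, z) ∈ K B)
    (hl : leftUnbounded K ⊆ {T, B}) (hr : rightUnbounded K ⊆ {T, B}) (t : ℝ) :
    ∃ y, (t, y) ∈ closure (K B) ∧ (t, y) ∈ closure (K T) := by
  obtain ⟨t₁, y₁, ht₁, hB₁, hT₁⟩ := h.exists_mem_closure_of_filter hT hB atBot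
    atBot_le_cofinite (fun i h1 h2 => by
      have : i ∉ leftUnbounded K := fun hi => by simpa [h1, h2] using hl hi
      simp only [leftUnbounded, Set.mem_ofPred_eq, not_forall, not_exists, not_and, not_lt] at this
      obtain ⟨c, hc⟩ := this
      filter_upwards [eventually_lt_atBot c] with t ht
      rintro ⟨y, hy⟩
      exact absurd (hc _ hy) (not_le.2 ht)) (fun u => u ≤ t) (eventually_le_atBot t)
  obtain ⟨t₂, y₂, ht₂, hB₂, hT₂⟩ := h.exists_mem_closure_of_filter hT hB atTop
    atTop_le_cofinite (fun i h1 h2 => by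
      have : i ∉ rightUnbounded K := fun hi => by simpa [h1, h2] using hr hi
      simp only [rightUnbounded, Set.mem_ofPred_eq, not_forall, not_exists, not_and, not_lt] at this
      obtain ⟨c, hc⟩ := this
      filter_upwards [eventually_gt_atTop c] with t ht
      rintro ⟨y, hy⟩
      exact absurd (hc _ hy) (not_le.2 ht)) (fun u => t ≤ u) (eventually_ge_atTop t)
  exact MeetsVertical.of_between ((h.convex B).closure.inter (h.convex T).closure)
    ⟨y₁, hB₁, hT₁⟩ ⟨y₂, hB₂, hT₂⟩ ht₁ ht₂

/-- Above the common closure point the vertical line lies in the closure of `K T`, below it in that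
of `K B`. -/
theorem eq_or_eq_of_mem_interior (h : SweepPartition K) {T B : ι}
    (hT : ∀ t, ∃ y, ∀ z, y ≤ z → (t, z) ∈ K T) (hB : ∀ t, ∃ y, ∀ z, z ≤ y → (t, z) ∈ K B)
    {p : ℝ × ℝ} (hc : ∃ y, (p.1, y) ∈ closure (K B) ∧ (p.1, y) ∈ closure (K T)) {i : ι}
    (hi : p ∈ interior (K i)) : i = T ∨ i = B := by
  obtain ⟨y, hyB, hyT⟩ := hc
  by_contra! hne
  rcases le_total y p.2 with hle | hle
  · obtain ⟨z, hz⟩ := hT p.1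
    exact h.disjoint_closure_interior hne.1.symm (mem_of_vertical_between (h.convex T).closure hyT
      (subset_closure (hz (max z p.2) (le_max_left _ _))) hle (le_max_right _ _)) hi
  · obtain ⟨z, hz⟩ := hB p.1
    exact h.disjoint_closure_interior hne.2.symm (mem_of_vertical_between (h.convex B).closure
      (subset_closure (hz (min z p.2) (min_le_left _ _))) hyB (min_le_right _ _) hle) hi

theorem ncard_edgePoints_le_one [Finite ι] (h : SweepPartition K) {T B : ι}
    (hT : ∀ t, ∃ y, ∀ z, y ≤ z → (t, z) ∈ K T) (hB : ∀ t, ∃ y, ∀ z, z ≤ y → (t, z) ∈ K B)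
    (hl : leftUnbounded K ⊆ {T, B}) (hr : rightUnbounded K ⊆ {T, B}) :
    (edgePoints K).ncard ≤ 1 := by
  have key : ∀ s ∈ (⋃ i, K i)ᶜ, IsNeighbourPair K s B T := by
    intro s hs
    obtain ⟨a, b, hp⟩ := h.exists_isNeighbourPair hs
    have hab := h.isBelow_of_pair hs hp
    have hcl := h.exists_mem_closure_bottom_top hT hB hl hr s.1
    have ha : a = T ∨ a = B := by
      obtain ⟨ε, hε, hi⟩ := h.interior_below hs hp
      exact h.eq_or_eq_of_mem_interior hT hB (p := (s.1, s.2 - ε / 2)) hcl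
        (hi _ (by linarith) (by linarith))
    have hb : b = T ∨ b = B := by
      obtain ⟨ε, hε, hi⟩ := h.interior_above hs hp
      exact h.eq_or_eq_of_mem_interior hT hB (p := (s.1, s.2 + ε / 2)) hcl
        (hi _ (by linarith) (by linarith))
    have haT : a ≠ T := by
      rintro rfl
      obtain ⟨y, hy⟩ := hT s.1
      obtain ⟨z, hz⟩ := hp.meets_right
      have := h.lt_of_isBelow hab (hy (max y z) (le_max_left _ _)) hz
      exact absurd (le_max_right y z) (not_le.2 this)
    have hbB : b ≠ B := by
      rintro rfl
      obtain ⟨y, hy⟩ := hB s.1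
      obtain ⟨z, hz⟩ := hp.meets_left
      have := h.lt_of_isBelow hab hz (hy (min y z) (min_le_left _ _))
      exact absurd (min_le_right y z) (not_le.2 this)
    obtain rfl := ha.resolve_left haT
    obtain rfl := hb.resolve_right hbB
    exact hp
  refine (Set.ncard_le_one h.finite.sdiff).2 fun s hs s' hs' => ?_
  exact h.eq_of_pair hs hs' (key s hs.1) (key s' hs'.1)

/-- The upper bound when the vertical direction is generic. -/
theorem ncard_compl_le [Finite ι] (h : SweepPartition K) (hn : 3 ≤ Nat.card ι) :
    (⋃ i, K i)ᶜ.ncard ≤ 5 * Nat.card ι - 11 := by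
  obtain ⟨T, hT⟩ := h.exists_top
  obtain ⟨B, hB⟩ := h.exists_bottom
  by_cases hTB : T = B
  · have : (⋃ i, K i)ᶜ = ∅ := by
      refine eq_empty_of_forall_notMem fun s hs => hs (mem_iUnion.2 ⟨T, ?_⟩)
      obtain ⟨y, hy⟩ := hT s.1
      obtain ⟨z, hz⟩ := hB s.1
      exact mem_of_vertical_between (h.convex T) (hTB ▸ hz (min z s.2) (min_le_left _ _))
        (hy (max y s.2) (le_max_left _ _)) (min_le_right _ _) (le_max_right _ _)
    simp [this]
  have hpair : ({T, B} : Set ι).ncard = 2 := Set.ncard_pair hTB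
  have hLT : ∀ {i}, (∀ t, MeetsVertical (K i) t) → i ∈ leftUnbounded K := fun hi c => by
    obtain ⟨y, hy⟩ := hi (c - 1)
    exact ⟨_, hy, by simp⟩
  have hRT : ∀ {i}, (∀ t, MeetsVertical (K i) t) → i ∈ rightUnbounded K := fun hi c => by
    obtain ⟨y, hy⟩ := hi (c + 1)
    exact ⟨_, hy, by simp⟩
  have mT : ∀ t, MeetsVertical (K T) t := fun t => by
    obtain ⟨y, hy⟩ := hT t
    exact ⟨y, hy y le_rfl⟩
  have mB : ∀ t, MeetsVertical (K B) t := fun t => by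
    obtain ⟨y, hy⟩ := hB t
    exact ⟨y, hy y le_rfl⟩
  have hL : ({T, B} : Set ι) ⊆ leftUnbounded K := by
    rintro i (rfl | rfl)
    exacts [hLT mT, hLT mB]
  have hR : ({T, B} : Set ι) ⊆ rightUnbounded K := by
    rintro i (rfl | rfl)
    exacts [hRT mT, hRT mB]
  have cL := Set.ncard_add_ncard_compl (leftUnbounded K)
  have cR := Set.ncard_add_ncard_compl (rightUnbounded K)
  have cT := Set.ncard_add_ncard_compl ({T} : Set ι)
  rw [Set.ncard_singleton] at cT
  have b0 := h.ncard_compl_le_add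
  have b1 := h.ncard_birthPoints_le
  have b2 := h.ncard_deathPoints_le
  have b3 := h.ncard_edgePoints_le hT
  have kL := Set.ncard_le_ncard hL (Set.toFinite _)
  have kR := Set.ncard_le_ncard hR (Set.toFinite _)
  rw [hpair] at kL kR
  -- If both counts are 2, the total is at most `2(n - 2) + 1 ≤ 5n - 11`; otherwise their sum is at
  -- least 5 and `5n - 1 - 2 · 5` is the bound.
  by_cases hk : (leftUnbounded K).ncard + (rightUnbounded K).ncard ≤ 4
  · have eL := Set.eq_of_subset_of_ncard_le hL (by omega) (Set.toFinite _)
    have eR := Set.eq_of_subset_of_ncard_le hR (by omega) (Set.toFinite _)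
    have b4 := h.ncard_edgePoints_le_one hT hB eL.ge eR.ge
    omega
  · omega

end SweepPartition

/-! ### Choosing a generic direction. -/

/-- The image of `K` under the shear that makes the direction `(m, 1)` vertical. -/
def shearSet (m : ℝ) (K : Set (ℝ × ℝ)) : Set (ℝ × ℝ) := {p | (p.1 + m * p.2, p.2) ∈ K}

/-- The slopes `m` for which `K` contains a ray in direction `σ • (m, 1)`. -/
def raySlopes (σ : ℝ) (K : Set (ℝ × ℝ)) : Set ℝ :=
  {m | ∃ t y, ∀ z, y ≤ σ * z → (t + m * z, z) ∈ K}

/-- The slopes `m` for which the line through `s` in direction `(m, 1)` supports `K`, touching it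
at some point. The signs `τ` and `ρ` select the side of `K` and of the touching point. -/
def supportSlopes (τ ρ : ℝ) (s : ℝ × ℝ) (K : Set (ℝ × ℝ)) : Set ℝ :=
  {m | (∃ p ∈ K, p.1 - s.1 = m * (p.2 - s.2) ∧ 0 < ρ * (p.2 - s.2)) ∧
    ∀ p ∈ K, 0 ≤ τ * (p.1 - s.1 - m * (p.2 - s.2))}

/-- For two slopes, the touching points lie on the same side of `s`, so each cannot be on the
allowed side of the other's line. -/
theorem subsingleton_supportSlopes {τ ρ : ℝ} (hτ : τ ≠ 0) (s : ℝ × ℝ) (K : Set (ℝ × ℝ)) :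
    (supportSlopes τ ρ s K).Subsingleton := by
  rintro m ⟨⟨p, hp, hpe, hpρ⟩, hm⟩ m' ⟨⟨q, hq, hqe, hqρ⟩, hm'⟩
  have h1 := hm' p hp
  have h2 := hm q hq
  rw [hpe] at h1
  rw [hqe] at h2
  have h3 := mul_nonneg h1 h2
  have h4 := mul_pos hpρ hqρ
  by_contra hne
  have hne' : m - m' ≠ 0 := sub_ne_zero.2 hne
  have h5 : 0 < (τ * (m - m')) ^ 2 := by positivity
  have h7 := mul_nonneg h3 (sq_nonneg ρ)
  have h8 := mul_pos h5 h4
  have h9 : τ * (m * (p.2 - s.2) - m' * (p.2 - s.2)) * (τ * (m' * (q.2 - s.2) - m * (q.2 - s.2)))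
      * ρ ^ 2 = -((τ * (m - m')) ^ 2 * (ρ * (p.2 - s.2) * (ρ * (q.2 - s.2)))) := by ring
  linarith

/-- With rays of both sets in two directions, a point of `K` and a point of `L` arise far out as the
same midpoint. -/
theorem subsingleton_raySlopes_inter {σ : ℝ} (hσ : σ * σ = 1) {K L : Set (ℝ × ℝ)}
    (hK : Convex ℝ K) (hL : Convex ℝ L) (hd : Disjoint K L) :
    (raySlopes σ K ∩ raySlopes σ L).Subsingleton := by
  rintro m ⟨⟨t, y, h1⟩, ⟨r, w, h2⟩⟩ m' ⟨⟨t', y', h1'⟩, ⟨r', w', h2'⟩⟩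
  by_contra hne
  have hne' : m - m' ≠ 0 := sub_ne_zero.2 hne
  -- Shifting the heights on the two rays of `K` by `e` and `-e` keeps the midpoint's height and
  -- moves it horizontally onto the midpoint for `L`.
  set e := ((r + r') - (t + t')) / (m - m') with he
  have hme : (m - m') * e = (r + r') - (t + t') := by rw [he]; field_simp
  set M := |y| + |y'| + |w| + |w'| + |σ * e| with hM
  have a1 := le_abs_self y
  have a2 := le_abs_self y'
  have a3 := le_abs_self w
  have a4 := le_abs_self w'
  have a5 := le_abs_self (σ * e)
  have a6 := neg_abs_le (σ * e)
  have b1 := abs_nonneg y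
  have b2 := abs_nonneg y'
  have b3 := abs_nonneg w
  have b4 := abs_nonneg w'
  have hσM : σ * (σ * M) = M := by rw [← mul_assoc, hσ, one_mul]
  have k1 := h1 (σ * M + e) (by rw [mul_add, hσM]; linarith)
  have k2 := h1' (σ * M - e) (by rw [mul_sub, hσM]; linarith)
  have l1 := h2 (σ * M) (by rw [hσM]; linarith)
  have l2 := h2' (σ * M) (by rw [hσM]; linarith)
  have k := hK k1 k2 (a := 1 / 2) (b := 1 / 2) (by norm_num) (by norm_num) (by norm_num)
  have l := hL l1 l2 (a := 1 / 2) (b := 1 / 2) (by norm_num) (by norm_num) (by norm_num)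
  refine Set.disjoint_left.1 hd k ?_
  convert l using 1
  ext
  · simp
    linear_combination (1 / 2) * hme
  · simp
    ring

theorem convex_shearSet (m : ℝ) {K : Set (ℝ × ℝ)} (hK : Convex ℝ K) : Convex ℝ (shearSet m K) := by
  intro p hp q hq a b ha hb hab
  have := hK hp hq ha hb hab
  simp only [shearSet, Set.mem_ofPred_eq]
  convert this using 1
  ext
  · simp; ring
  · simp

theorem compl_iUnion_shearSet {ι : Type*} (m : ℝ) (K : ι → Set (ℝ × ℝ)) :
    (⋃ i, shearSet m (K i))ᶜ = (fun p : ℝ × ℝ => (p.1 - m * p.2, p.2)) '' (⋃ i, K i)ᶜ := by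
  ext p
  constructor
  · intro hp
    refine ⟨(p.1 + m * p.2, p.2), fun hc => hp ?_, by simp⟩
    obtain ⟨i, hi⟩ := mem_iUnion.1 hc
    exact mem_iUnion.2 ⟨i, hi⟩
  · rintro ⟨q, hq, rfl⟩ hc
    obtain ⟨i, hi⟩ := mem_iUnion.1 hc
    refine hq (mem_iUnion.2 ⟨i, ?_⟩)
    simpa [shearSet] using hi

theorem injective_shear (m : ℝ) :
    Function.Injective fun p : ℝ × ℝ => (p.1 - m * p.2, p.2) := by
  rintro ⟨a, b⟩ ⟨c, d⟩ h
  simp only [Prod.mk.injEq] at h ⊢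
  obtain ⟨h1, rfl⟩ := h
  exact ⟨by linarith, rfl⟩

theorem exists_sweepPartition_shear {ι : Type*} [Finite ι] {K : ι → Set (ℝ × ℝ)}
    (hconv : ∀ i, Convex ℝ (K i)) (hdisj : ∀ i j, i ≠ j → Disjoint (K i) (K j))
    (hfin : (⋃ i, K i)ᶜ.Finite) : ∃ m, SweepPartition fun i => shearSet m (K i) := by
  set S := (⋃ i, K i)ᶜ with hS
  -- Each genericity condition fails for finitely many slopes only: `f1` serves `injOn_fst`, `f2`
  -- serves `crosses`, `f3` serves `eq_of_up` and `eq_of_down`.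
  have f1 : (⋃ s ∈ S, ⋃ s' ∈ S, ⋃ (_ : s ≠ s'),
      {m : ℝ | s.1 - m * s.2 = s'.1 - m * s'.2}).Finite := by
    refine hfin.biUnion fun s _ => hfin.biUnion fun s' _ => Set.finite_iUnion fun hne => ?_
    refine Set.Subsingleton.finite fun m hm m' hm' => ?_
    simp only [Set.mem_ofPred_eq] at hm hm'
    by_contra hmm
    have h2 : s.2 = s'.2 := by
      have : (m - m') * (s.2 - s'.2) = 0 := by linear_combination hm' - hm
      rcases mul_eq_zero.1 this with h | h
      · exact absurd (sub_eq_zero.1 h) hmm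
      · exact sub_eq_zero.1 h
    refine hne (Prod.ext ?_ h2)
    rw [h2] at hm
    linarith
  have f2 : (⋃ s ∈ S, ⋃ i, ⋃ τ ∈ ({1, -1} : Set ℝ), ⋃ ρ ∈ ({1, -1} : Set ℝ),
      supportSlopes τ ρ s (K i)).Finite := by
    refine hfin.biUnion fun s _ => Set.finite_iUnion fun i => (Set.toFinite _).biUnion fun τ hτ =>
      (Set.toFinite _).biUnion fun ρ _ => (subsingleton_supportSlopes ?_ _ _).finite
    rcases hτ with rfl | rfl <;> norm_num
  have f3 : (⋃ i, ⋃ j, ⋃ (_ : i ≠ j), ⋃ σ ∈ ({1, -1} : Set ℝ),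
      raySlopes σ (K i) ∩ raySlopes σ (K j)).Finite := by
    refine Set.finite_iUnion fun i => Set.finite_iUnion fun j => Set.finite_iUnion fun hne =>
      (Set.toFinite _).biUnion fun σ hσ => (subsingleton_raySlopes_inter ?_ (hconv i) (hconv j)
        (hdisj i j hne)).finite
    rcases hσ with rfl | rfl <;> norm_num
  obtain ⟨m, hm⟩ := ((f1.union f2).union f3).infinite_compl.nonempty
  simp only [mem_compl_iff, mem_union, mem_iUnion, not_or, not_exists] at hm
  obtain ⟨⟨g1, g2⟩, g3⟩ := hm
  have eqray : ∀ σ ∈ ({1, -1} : Set ℝ), ∀ i j, m ∈ raySlopes σ (K i) → m ∈ raySlopes σ (K j) →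
      i = j := by
    intro σ hσ i j h1 h2
    by_contra hne
    exact g3 i j hne σ hσ ⟨h1, h2⟩
  have cross : ∀ s ∈ S, ∀ i y, (s.1 - m * s.2 + m * y, y) ∈ K i → ∀ τ ∈ ({1, -1} : Set ℝ),
      ∃ p ∈ K i, τ * (p.1 - s.1 - m * (p.2 - s.2)) < 0 := by
    intro s hs i y hy τ hτ
    by_contra! hc
    rcases lt_trichotomy y s.2 with hlt | heq | hlt
    · exact g2 s hs i τ hτ (-1) (by simp) ⟨⟨_, hy, by simp; ring, by simpa using hlt⟩, hc⟩
    · refine hs (mem_iUnion.2 ⟨i, ?_⟩)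
      subst heq
      simpa using hy
    · exact g2 s hs i τ hτ 1 (by simp) ⟨⟨_, hy, by simp; ring, by simpa using hlt⟩, hc⟩
  refine ⟨m, fun i => convex_shearSet m (hconv i), fun i j hne => ?_, ?_, ?_, ?_, ?_, ?_⟩
  · exact Set.disjoint_left.2 fun p h1 h2 => Set.disjoint_left.1 (hdisj i j hne) h1 h2
  · rw [compl_iUnion_shearSet]
    exact hfin.image _
  · rw [compl_iUnion_shearSet]
    rintro _ ⟨s, hs, rfl⟩ _ ⟨s', hs', rfl⟩ he
    by_contra hne
    exact g1 s hs s' hs' (fun h => hne (by rw [h])) he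
  · rw [compl_iUnion_shearSet]
    rintro _ ⟨s, hs, rfl⟩ i ⟨y, hy⟩
    obtain ⟨p, hp, hpl⟩ := cross s hs i y hy 1 (by simp)
    obtain ⟨q, hq, hql⟩ := cross s hs i y hy (-1) (by simp)
    refine ⟨⟨(p.1 - m * p.2, p.2), by simpa [shearSet] using hp, ?_⟩,
      (q.1 - m * q.2, q.2), by simpa [shearSet] using hq, ?_⟩
    · simp only
      linarith
    · simp only
      linarith
  · intro i j t t' y y' h1 h2
    exact eqray 1 (by simp) i j ⟨t, y, fun z hz => h1 z (by linarith)⟩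
      ⟨t', y', fun z hz => h2 z (by linarith)⟩
  · intro i j t t' y y' h1 h2
    exact eqray (-1) (by simp) i j ⟨t, -y, fun z hz => h1 z (by linarith)⟩
      ⟨t', -y', fun z hz => h2 z (by linarith)⟩

/-- At most `5 n - 11` points remain uncovered by `n ≥ 3` disjoint convex plane sets. -/
theorem ncard_compl_iUnion_le {ι : Type*} [Finite ι] {K : ι → Set (ℝ × ℝ)}
    (hconv : ∀ i, Convex ℝ (K i)) (hdisj : ∀ i j, i ≠ j → Disjoint (K i) (K j))
    (hfin : (⋃ i, K i)ᶜ.Finite) (hn : 3 ≤ Nat.card ι) :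
    (⋃ i, K i)ᶜ.ncard ≤ 5 * Nat.card ι - 11 := by
  obtain ⟨m, hm⟩ := exists_sweepPartition_shear hconv hdisj hfin
  have := hm.ncard_compl_le hn
  rwa [compl_iUnion_shearSet, Set.ncard_image_of_injective _ (injective_shear m)] at this

/-! ### The extremal construction: truncating a vertex. -/

/-- Cutting a convex plane set by a half-plane and keeping a convex part of the boundary line gives
a convex set. -/
theorem convex_cut {X : Set (ℝ × ℝ)} (hX : Convex ℝ X) (α β r γ δ : ℝ) {I : Set ℝ}
    (hI : Convex ℝ I) :
    Convex ℝ {p ∈ X | r ≤ α * p.1 + β * p.2 ∧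
      (r < α * p.1 + β * p.2 ∨ γ * p.1 + δ * p.2 ∈ I)} := by
  rintro p ⟨hp, hp1, hp2⟩ q ⟨hq, hq1, hq2⟩ a b ha hb hab
  have e1 : α * (a • p + b • q).1 + β * (a • p + b • q).2 - r =
      a * (α * p.1 + β * p.2 - r) + b * (α * q.1 + β * q.2 - r) := by
    simp; linear_combination r * hab
  have e2 : γ * (a • p + b • q).1 + δ * (a • p + b • q).2 =
      a • (γ * p.1 + δ * p.2) + b • (γ * q.1 + δ * q.2) := by
    simp; ring
  have n1 := mul_nonneg ha (sub_nonneg.2 hp1)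
  have n2 := mul_nonneg hb (sub_nonneg.2 hq1)
  refine ⟨hX hp hq ha hb hab, by linarith, ?_⟩
  rcases ha.eq_or_lt with rfl | ha'
  · obtain rfl : b = 1 := by linarith
    simpa using hq2
  rcases hb.eq_or_lt with rfl | hb'
  · obtain rfl : a = 1 := by linarith
    simpa using hp2
  rcases hp2 with hp2 | hp2
  · left
    linarith [mul_pos ha' (sub_pos.2 hp2)]
  rcases hq2 with hq2 | hq2
  · left
    linarith [mul_pos hb' (sub_pos.2 hq2)]
  · right
    rw [e2]
    exact hI hp2 hq2 ha hb hab

/-- A family of disjoint convex plane sets with finite complement for which the origin is an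
uncovered vertex where exactly three of the sets meet. -/
structure YConfig {ι : Type*} (K : ι → Set (ℝ × ℝ)) (a b c : ι) : Prop where
  convex : ∀ i, Convex ℝ (K i)
  disjoint : ∀ i j, i ≠ j → Disjoint (K i) (K j)
  finite : (⋃ i, K i)ᶜ.Finite
  zero_mem : ((0, 0) : ℝ × ℝ) ∈ (⋃ i, K i)ᶜ
  sub_a : ∀ p ∈ K a, 0 ≤ p.1 ∧ 0 ≤ p.2
  sub_b : ∀ p ∈ K b, p.1 ≤ 0 ∧ p.1 ≤ p.2
  sub_c : ∀ p ∈ K c, p.2 ≤ 0 ∧ p.2 ≤ p.1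
  -- Near the origin each sector owns exactly one of its two boundary rays, in cyclic fashion.
  near : ∃ ε > 0, ∀ p : ℝ × ℝ, |p.1| < ε → |p.2| < ε →
    (0 < p.1 → 0 ≤ p.2 → p ∈ K a) ∧ (p.1 ≤ 0 → p.1 < p.2 → p ∈ K b) ∧
      (p.2 < 0 → p.2 ≤ p.1 → p ∈ K c)

theorem YConfig.reindex {ι κ : Type*} {K : ι → Set (ℝ × ℝ)} {a b c : ι} (h : YConfig K a b c)
    (e : κ ≃ ι) : YConfig (fun i => K (e i)) (e.symm a) (e.symm b) (e.symm c) := by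
  have hU : (⋃ i, K (e i)) = ⋃ i, K i := e.surjective.iUnion_comp K
  exact
    { convex := fun i => h.convex _
      disjoint := fun i j hne => h.disjoint _ _ (e.injective.ne hne)
      finite := hU ▸ h.finite
      zero_mem := hU ▸ h.zero_mem
      sub_a := by simpa using h.sub_a
      sub_b := by simpa using h.sub_b
      sub_c := by simpa using h.sub_c
      near := by simpa using h.near }

/-- The triangle with vertices `(r, 0)`, `(0, r)`, `(-r, -r)`, with the half of each side next to
one of its end points. -/
def cornerTriangle (r : ℝ) : Set (ℝ × ℝ) :=
  {p | (p.1 + p.2 < r ∨ p.1 + p.2 = r ∧ r / 2 < p.1 ∧ p.1 < r) ∧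
    (p.2 - 2 * p.1 < r ∨ p.2 - 2 * p.1 = r ∧ -(r / 2) < p.1 ∧ p.1 < 0) ∧
    (p.1 - 2 * p.2 < r ∨ p.1 - 2 * p.2 = r ∧ -r < p.2 ∧ p.2 < -(r / 2))}

/-- The vertices and the midpoints of the sides of the corner triangle. -/
def cornerPoints (r : ℝ) : Set (ℝ × ℝ) :=
  {(r, 0), (0, r), (-r, -r), (r / 2, r / 2), (-(r / 2), 0), (0, -(r / 2))}

theorem convex_cornerTriangle (r : ℝ) : Convex ℝ (cornerTriangle r) := by
  have h1 := convex_cut convex_univ (-1) (-1) (-r) 1 0 (convex_Ioo (r / 2) r)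
  have h2 := convex_cut convex_univ 2 (-1) (-r) 1 0 (convex_Ioo (-(r / 2)) 0)
  have h3 := convex_cut convex_univ (-1) 2 (-r) 0 1 (convex_Ioo (-r) (-(r / 2)))
  convert (h1.inter h2).inter h3 using 1
  ext ⟨x, y⟩
  simp only [cornerTriangle, Set.mem_ofPred_eq, mem_inter_iff, mem_univ, true_and, mem_Ioo]
  grind

theorem ncard_cornerPoints {r : ℝ} (hr : 0 < r) : (cornerPoints r).ncard = 6 := by
  have h0 : r ≠ 0 := hr.ne'
  have h1 : r / 2 ≠ 0 := by positivity
  unfold cornerPoints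
  repeat rw [Set.ncard_insert_of_notMem]
  · rw [Set.ncard_singleton]
  all_goals
    simp only [Set.mem_insert_iff, Set.mem_singleton_iff, Prod.mk.injEq, not_or, not_and_or]
    grind

theorem mem_cornerPoints {r : ℝ} {p : ℝ × ℝ} : p ∈ cornerPoints r ↔
    (p.1 = r ∧ p.2 = 0) ∨ (p.1 = 0 ∧ p.2 = r) ∨ (p.1 = -r ∧ p.2 = -r) ∨
      (p.1 = r / 2 ∧ p.2 = r / 2) ∨ (p.1 = -(r / 2) ∧ p.2 = 0) ∨ (p.1 = 0 ∧ p.2 = -(r / 2)) := by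
  simp [cornerPoints, Prod.ext_iff]

/-- Truncating the vertex at the origin by the corner triangle. -/
def truncateCorner {ι : Type*} (r : ℝ) (K : ι → Set (ℝ × ℝ)) : Option ι → Set (ℝ × ℝ)
  | none => cornerTriangle r
  | some i => K i \ (cornerTriangle r ∪ cornerPoints r)

namespace YConfig

variable {ι : Type*} {K : ι → Set (ℝ × ℝ)} {a b c : ι}

theorem convex_truncate_a (h : YConfig K a b c) {r : ℝ} (hr : 0 < r) :
    Convex ℝ (K a \ (cornerTriangle r ∪ cornerPoints r)) := by
  convert convex_cut (h.convex a) 1 1 r 1 0 (convex_Ioo 0 (r / 2)) using 1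
  ext ⟨x, y⟩
  simp only [Set.mem_sdiff, mem_union, mem_cornerPoints, cornerTriangle, Set.mem_ofPred_eq, mem_Ioo]
  refine and_congr_right fun hp => ?_
  have := h.sub_a _ hp
  grind

theorem convex_truncate_b (h : YConfig K a b c) {r : ℝ} (hr : 0 < r) :
    Convex ℝ (K b \ (cornerTriangle r ∪ cornerPoints r)) := by
  convert convex_cut (h.convex b) (-2) 1 r 1 0 (convex_Ioo (-r) (-(r / 2))) using 1
  ext ⟨x, y⟩
  simp only [Set.mem_sdiff, mem_union, mem_cornerPoints, cornerTriangle, Set.mem_ofPred_eq, mem_Ioo]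
  refine and_congr_right fun hp => ?_
  have := h.sub_b _ hp
  grind

theorem convex_truncate_c (h : YConfig K a b c) {r : ℝ} (hr : 0 < r) :
    Convex ℝ (K c \ (cornerTriangle r ∪ cornerPoints r)) := by
  convert convex_cut (h.convex c) 1 (-2) r 0 1 (convex_Ioo (-(r / 2)) 0) using 1
  ext ⟨x, y⟩
  simp only [Set.mem_sdiff, mem_union, mem_cornerPoints, cornerTriangle, Set.mem_ofPred_eq, mem_Ioo]
  refine and_congr_right fun hp => ?_
  have := h.sub_c _ hp
  grind

end YConfig

namespace YConfig

variable {ι : Type*} {K : ι → Set (ℝ × ℝ)} {a b c : ι}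

theorem eq_of_mem (h : YConfig K a b c) {i j : ι} {p : ℝ × ℝ} (hi : p ∈ K i) (hj : p ∈ K j) :
    i = j := by
  by_contra hne
  exact Set.disjoint_left.1 (h.disjoint i j hne) hi hj

theorem mem_or_mem_of_near {ε : ℝ}
    (hε : ∀ p : ℝ × ℝ, |p.1| < ε → |p.2| < ε →
      (0 < p.1 → 0 ≤ p.2 → p ∈ K a) ∧ (p.1 ≤ 0 → p.1 < p.2 → p ∈ K b) ∧
        (p.2 < 0 → p.2 ≤ p.1 → p ∈ K c)) {p : ℝ × ℝ} (h1 : |p.1| < ε) (h2 : |p.2| < ε)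
    (hne : p ≠ (0, 0)) : p ∈ K a ∨ p ∈ K b ∨ p ∈ K c := by
  obtain ⟨ha, hb, hc⟩ := hε p h1 h2
  by_cases hc' : p.2 < 0 ∧ p.2 ≤ p.1
  · exact Or.inr (Or.inr (hc hc'.1 hc'.2))
  by_cases hb' : p.1 ≤ 0 ∧ p.1 < p.2
  · exact Or.inr (Or.inl (hb hb'.1 hb'.2))
  refine Or.inl (ha ?_ ?_)
  · by_contra hx
    exact hne (Prod.ext (by grind) (by grind))
  · grind

theorem abs_lt_of_mem_triangle {r : ℝ} (hr : 0 < r) {p : ℝ × ℝ}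
    (hp : p ∈ cornerTriangle r ∪ cornerPoints r) : |p.1| < 2 * r ∧ |p.2| < 2 * r := by
  simp only [mem_union, mem_cornerPoints, cornerTriangle, Set.mem_ofPred_eq] at hp
  rw [abs_lt, abs_lt]
  grind

/-- The vertex at the origin of a `YConfig` can be truncated, which adds one set and five points. -/
theorem exists_truncate (h : YConfig K a b c) : ∃ K' : Option ι → Set (ℝ × ℝ),
    YConfig K' (some a) none (some c) ∧ (⋃ i, K' i)ᶜ.ncard = (⋃ i, K i)ᶜ.ncard + 5 := by
  obtain ⟨ε, hε, hnear⟩ := h.near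
  -- The triangle and its marked points then stay inside the box where only `K a`, `K b`, `K c`
  -- occur.
  obtain ⟨r, hr, rfl⟩ : ∃ r > 0, ε = 2 * r := ⟨ε / 2, by positivity, by ring⟩
  set D := truncateCorner r K with hD
  set S := (⋃ i, K i)ᶜ with hS
  have hzero : ((0, 0) : ℝ × ℝ) ∈ cornerTriangle r := by
    simp [cornerTriangle, hr]
  have hP : ∀ p ∈ cornerPoints r, p ∉ cornerTriangle r := by
    intro p hp
    rw [mem_cornerPoints] at hp
    simp only [cornerTriangle, Set.mem_ofPred_eq]
    grind
  have hout : ∀ p ∈ S \ {(0, 0)}, p ∉ cornerTriangle r ∪ cornerPoints r := by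
    rintro p ⟨hp, hne⟩ hm
    obtain ⟨h1, h2⟩ := abs_lt_of_mem_triangle hr hm
    rcases mem_or_mem_of_near hnear h1 h2 hne with hi | hi | hi <;>
      exact hp (mem_iUnion.2 ⟨_, hi⟩)
  have hcompl : (⋃ i, D i)ᶜ = S \ {(0, 0)} ∪ cornerPoints r := by
    ext p
    simp only [mem_compl_iff, mem_iUnion, Option.exists, not_or, not_exists]
    constructor
    · rintro ⟨h1, h2⟩
      by_cases hpP : p ∈ cornerPoints r
      · exact Or.inr hpP
      · refine Or.inl ⟨fun hc => ?_, ?_⟩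
        · obtain ⟨i, hi⟩ := mem_iUnion.1 hc
          exact h2 i ⟨hi, fun hm => hm.elim h1 hpP⟩
        · rintro rfl
          exact h1 hzero
    · rintro (hp | hp)
      · exact ⟨fun hm => hout p hp (Or.inl hm), fun i hi => hp.1 (mem_iUnion.2 ⟨i, hi.1⟩)⟩
      · exact ⟨hP p hp, fun i hi => hi.2 (Or.inr hp)⟩
  have hfinP : (cornerPoints r).Finite := by
    unfold cornerPoints
    exact Set.toFinite _
  have hfin : (⋃ i, D i)ᶜ.Finite := hcompl ▸ (h.finite.sdiff).union hfinP
  have hcard : (⋃ i, D i)ᶜ.ncard = S.ncard + 5 := by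
    rw [hcompl, Set.ncard_union_eq (Set.disjoint_left.2 fun p hp hm => hout p hp (Or.inr hm))
      h.finite.sdiff hfinP, ncard_cornerPoints hr]
    have : (S \ {(0, 0)}).ncard + 1 = S.ncard :=
      Set.ncard_sdiff_singleton_add_one h.zero_mem h.finite
    omega
  have hconv : ∀ i, Convex ℝ (D i) := by
    rintro (_ | i)
    · exact convex_cornerTriangle r
    change Convex ℝ (K i \ (cornerTriangle r ∪ cornerPoints r))
    by_cases ha : i = a
    · exact ha ▸ h.convex_truncate_a hr
    by_cases hb : i = b
    · exact hb ▸ h.convex_truncate_b hr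
    by_cases hc : i = c
    · exact hc ▸ h.convex_truncate_c hr
    convert h.convex i using 1
    refine sdiff_eq_left.2 (Set.disjoint_left.2 fun p hp hm => ?_)
    obtain ⟨h1, h2⟩ := abs_lt_of_mem_triangle hr hm
    have hne : p ≠ (0, 0) := by
      rintro rfl
      exact h.zero_mem (mem_iUnion.2 ⟨i, hp⟩)
    rcases mem_or_mem_of_near hnear h1 h2 hne with hi | hi | hi
    exacts [ha (h.eq_of_mem hp hi), hb (h.eq_of_mem hp hi), hc (h.eq_of_mem hp hi)]
  have hdisj : ∀ i j, i ≠ j → Disjoint (D i) (D j) := by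
    rintro (_ | i) (_ | j) hne
    · exact absurd rfl hne
    · exact Set.disjoint_left.2 fun p h1 h2 => h2.2 (Or.inl h1)
    · exact Set.disjoint_left.2 fun p h1 h2 => h1.2 (Or.inl h2)
    · exact Set.disjoint_left.2 fun p h1 h2 =>
        Set.disjoint_left.1 (h.disjoint i j fun e => hne (e ▸ rfl)) h1.1 h2.1
  -- This affine map sends the origin to the corner `(r, 0)` and the three model sectors to the
  -- local sectors of `K a`, the triangle (in the role of `b`) and `K c`.
  let φ : ℝ × ℝ ≃ ℝ × ℝ :=
    { toFun := fun p => (r + 3 * p.1 - p.2, p.2)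
      invFun := fun p => ((p.1 + p.2 - r) / 3, p.2)
      left_inv := fun p => by ext <;> simp
      right_inv := fun p => by ext <;> simp; ring }
  have hφ : ∀ p, φ p = (r + 3 * p.1 - p.2, p.2) := fun _ => rfl
  have hU : (⋃ i, φ ⁻¹' D i)ᶜ = φ ⁻¹' (⋃ i, D i)ᶜ := by
    rw [preimage_compl, preimage_iUnion]
  -- Radius `r / 4` keeps the image under `φ` within the box of half-width `2 * r` and short of the
  -- side midpoints, where ownership switches.
  refine ⟨fun i => φ ⁻¹' D i, ⟨?_, ?_, ?_, ?_, ?_, ?_, ?_, r / 4, by positivity, ?_⟩, ?_⟩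
  · intro i p hp q hq u v hu hv huv
    have := hconv i hp hq hu hv huv
    rw [mem_preimage]
    convert this using 1
    simp only [hφ]
    ext
    · simp
      linear_combination (-r) * huv
    · simp
  · exact fun i j hne => (hdisj i j hne).preimage φ
  · rw [hU]
    exact hfin.preimage φ.injective.injOn
  · rw [hU, hcompl]
    refine Or.inr ?_
    rw [hφ, mem_cornerPoints]
    simp
  · rintro p ⟨hp, hm⟩
    have := h.sub_a _ hp
    rw [hφ] at hm this
    simp only [mem_union, mem_cornerPoints, cornerTriangle, Set.mem_ofPred_eq] at hm this
    grind
  · rintro p hp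
    change φ p ∈ cornerTriangle r at hp
    rw [hφ] at hp
    simp only [cornerTriangle, Set.mem_ofPred_eq] at hp
    grind
  · rintro p ⟨hp, hm⟩
    have := h.sub_c _ hp
    rw [hφ] at hm this
    simp only [mem_union, mem_cornerPoints, cornerTriangle, Set.mem_ofPred_eq] at hm this
    grind
  · rintro ⟨x, y⟩ hx hy
    rw [abs_lt] at hx hy
    simp only at hx hy
    have hq := hnear (φ (x, y)) (by rw [hφ, abs_lt]; constructor <;> simp only <;> linarith)
      (by rw [hφ, abs_lt]; constructor <;> simp only <;> linarith)
    refine ⟨fun h1 h2 => ⟨hq.1 (by rw [hφ]; simp only; linarith) h2, ?_⟩, fun h1 h2 => ?_,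
      fun h1 h2 => ⟨hq.2.2 h1 (by rw [hφ]; simp only at h2 ⊢; linarith), ?_⟩⟩
    · rw [hφ]
      simp only [mem_union, mem_cornerPoints, cornerTriangle, Set.mem_ofPred_eq]
      simp only at h1 h2
      grind
    · change φ (x, y) ∈ cornerTriangle r
      rw [hφ]
      simp only [cornerTriangle, Set.mem_ofPred_eq]
      simp only at h1 h2
      grind
    · rw [hφ]
      simp only [mem_union, mem_cornerPoints, cornerTriangle, Set.mem_ofPred_eq]
      simp only at h1 h2
      grind
  · rw [hU, ← hcard]
    exact Set.ncard_preimage_of_injective_subset_range φ.injective (by simp)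

end YConfig

/-! ### Base case and induction. -/

/-- Three sectors whose complement consists of their apex and one point on each common ray. -/
def threeSectors : Fin 3 → Set (ℝ × ℝ) :=
  ![{p | (0 ≤ p.2 ∧ (0 < p.2 ∨ 0 < p.1 ∧ p.1 < 2)) ∧ (0 ≤ p.1 ∧ (0 < p.1 ∨ 2 < p.2))},
    {p | (p.1 ≤ 0 ∧ (p.1 < 0 ∨ 0 < p.2 ∧ p.2 < 2)) ∧ (p.1 ≤ p.2 ∧ (p.1 < p.2 ∨ p.1 < -2))},
    {p | (p.2 ≤ p.1 ∧ (p.2 < p.1 ∨ -2 < p.1 ∧ p.1 < 0)) ∧ (p.2 ≤ 0 ∧ (p.2 < 0 ∨ 2 < p.1))}]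

theorem compl_iUnion_threeSectors :
    (⋃ i, threeSectors i)ᶜ = {(0, 0), (2, 0), (0, 2), (-2, -2)} := by
  ext ⟨x, y⟩
  simp only [mem_compl_iff, mem_iUnion, Fin.exists_fin_succ, threeSectors, Fin.isValue,
    Matrix.cons_val_zero, Matrix.cons_val_succ, Set.mem_ofPred_eq, IsEmpty.exists_iff, or_false,
    mem_insert_iff, mem_singleton_iff, Prod.mk.injEq]
  constructor
  · intro h
    by_contra hc
    rcases lt_trichotomy x 0 with hx | hx | hx <;> rcases lt_trichotomy y 0 with hy | hy | hy <;>
      rcases lt_trichotomy x y with hxy | hxy | hxy <;> grind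
  · rintro (⟨rfl, rfl⟩ | ⟨rfl, rfl⟩ | ⟨rfl, rfl⟩ | ⟨rfl, rfl⟩) <;> norm_num

theorem yConfig_threeSectors : YConfig threeSectors 0 1 2 := by
  refine ⟨?_, ?_, ?_, ?_, ?_, ?_, ?_, 1, one_pos, ?_⟩
  · have a1 := convex_cut convex_univ 0 1 0 1 0 (convex_Ioo (0 : ℝ) 2)
    have a2 := convex_cut convex_univ 1 0 0 0 1 (convex_Ioi (2 : ℝ))
    have b1 := convex_cut convex_univ (-1) 0 0 0 1 (convex_Ioo (0 : ℝ) 2)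
    have b2 := convex_cut convex_univ (-1) 1 0 1 0 (convex_Iio (-2 : ℝ))
    have c1 := convex_cut convex_univ 1 (-1) 0 1 0 (convex_Ioo (-2 : ℝ) 0)
    have c2 := convex_cut convex_univ 0 (-1) 0 1 0 (convex_Ioi (2 : ℝ))
    intro i
    fin_cases i
    · convert a1.inter a2 using 1
      ext ⟨x, y⟩
      simp [threeSectors]
    · convert b1.inter b2 using 1
      ext ⟨x, y⟩
      simp [threeSectors]
    · convert c1.inter c2 using 1
      ext ⟨x, y⟩
      simp [threeSectors]
  · intro i j hne
    rw [Set.disjoint_left]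
    rintro ⟨x, y⟩
    fin_cases i <;> fin_cases j <;> simp [threeSectors] at hne ⊢ <;> grind
  · rw [compl_iUnion_threeSectors]
    exact Set.toFinite _
  · rw [compl_iUnion_threeSectors]
    simp
  · rintro p ⟨⟨h1, -⟩, h2, -⟩
    exact ⟨h2, h1⟩
  · rintro p ⟨⟨h1, -⟩, h2, -⟩
    exact ⟨h1, h2⟩
  · rintro p ⟨⟨h1, -⟩, h2, -⟩
    exact ⟨h2, h1⟩
  · rintro ⟨x, y⟩ hx hy
    rw [abs_lt] at hx hy
    simp [threeSectors] at hx hy ⊢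
    grind

theorem ncard_compl_threeSectors : (⋃ i, threeSectors i)ᶜ.ncard = 4 := by
  rw [compl_iUnion_threeSectors]
  repeat rw [Set.ncard_insert_of_notMem]
  · rw [Set.ncard_singleton]
  all_goals norm_num

theorem exists_yConfig (n : ℕ) (hn : 3 ≤ n) : ∃ (K : Fin n → Set (ℝ × ℝ)) (a b c : Fin n),
    YConfig K a b c ∧ (⋃ i, K i)ᶜ.ncard = 5 * n - 11 := by
  induction n, hn using Nat.le_induction with
  | base => exact ⟨threeSectors, 0, 1, 2, yConfig_threeSectors, ncard_compl_threeSectors⟩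
  | succ n hn ih =>
    obtain ⟨K, a, b, c, hK, hcard⟩ := ih
    obtain ⟨K', hK', hcard'⟩ := hK.exists_truncate
    refine ⟨_, _, _, _, hK'.reindex (finSuccEquiv n), ?_⟩
    rw [(finSuccEquiv n).surjective.iUnion_comp K', hcard', hcard]
    omega

/-! ### Transfer to the Euclidean plane. -/

/-- Coordinates on the Euclidean plane. -/
noncomputable def planeEquiv : EuclideanSpace ℝ (Fin 2) ≃L[ℝ] ℝ × ℝ :=
  (EuclideanSpace.equiv (Fin 2) ℝ).trans (ContinuousLinearEquiv.finTwoArrow ℝ ℝ)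

theorem mainTheorem6 :
    ∀ n : ℕ, 3 ≤ n →
      -- the upper bound
      (∀ K : Fin n → Set (EuclideanSpace ℝ (Fin 2)),
        (∀ i, Convex ℝ (K i)) → (∀ i j, i ≠ j → Disjoint (K i) (K j)) →
        (⋃ i, K i)ᶜ.Finite →
        (⋃ i, K i)ᶜ.ncard ≤ 5 * n - 11) ∧
      -- the bound is attained
      (∃ K : Fin n → Set (EuclideanSpace ℝ (Fin 2)),
        (∀ i, Convex ℝ (K i)) ∧ (∀ i j, i ≠ j → Disjoint (K i) (K j)) ∧
        (⋃ i, K i)ᶜ.Finite ∧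
        (⋃ i, K i)ᶜ.ncard = 5 * n - 11) := by
  intro n hn
  constructor
  · intro K hconv hdisj hfin
    have hU : (⋃ i, planeEquiv.symm ⁻¹' K i)ᶜ = planeEquiv.symm ⁻¹' (⋃ i, K i)ᶜ := by
      rw [preimage_compl, preimage_iUnion]
    have := ncard_compl_iUnion_le (K := fun i => planeEquiv.symm ⁻¹' K i)
      (fun i => (hconv i).linear_preimage (planeEquiv.symm : ℝ × ℝ →ₗ[ℝ] _))
      (fun i j hne => (hdisj i j hne).preimage _)
      (hU ▸ hfin.preimage planeEquiv.symm.injective.injOn) (by simpa using hn)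
    rwa [hU, Set.ncard_preimage_of_injective_subset_range planeEquiv.symm.injective
      (by rw [planeEquiv.symm.surjective.range_eq]; exact subset_univ _), Nat.card_fin] at this
  · obtain ⟨K, a, b, c, hK, hcard⟩ := exists_yConfig n hn
    have hU : (⋃ i, planeEquiv ⁻¹' K i)ᶜ = planeEquiv ⁻¹' (⋃ i, K i)ᶜ := by
      rw [preimage_compl, preimage_iUnion]
    refine ⟨fun i => planeEquiv ⁻¹' K i, fun i => (hK.convex i).linear_preimage
      (planeEquiv : EuclideanSpace ℝ (Fin 2) →ₗ[ℝ] ℝ × ℝ), fun i j hne => (hK.disjoint i j hne).preimage _, ?_, ?_⟩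
    · rw [hU]
      exact hK.finite.preimage planeEquiv.injective.injOn
    · rw [hU, Set.ncard_preimage_of_injective_subset_range planeEquiv.injective
        (by rw [planeEquiv.surjective.range_eq]; exact subset_univ _), hcard]
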